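/- Let $n\ge 0$ and let $T$ be a standard Young tableau with $n$ cells, drawn in English notation. For a word $w$, let $P(w)$ be its Schensted (row) insertion tableau. The row reading word of a tableau, or of a piece of one, reads its rows from bottom to top, each from left to right; for pieces $A,B$ of a tableau, $P(AB)$ is the insertion tableau of the row reading word of $A$ followed by that of $B$. For $m$ at most the length of the first row of a tableau $T$, remove the first $m$ cells of the first row. The *$m$-catabolism* is $\mathrm{Cat}_m(T)=P(T_nT_s)$, where $T_n$ is the remaining part of the first row and $T_s$ consists of the other rows; the *$m$-column catabolism* is $\mathrm{CCat}_m(T)=P(T_eT_w)$, where $T_w$ is the remaining part of the first $m$ columns and $T_e$ consists of the other columns. For a partition $\lambda=(\lambda_1,\widehat\lambda)$ of the number of cells of $T$, call $T$ *$\lambda$-catabolizable* (resp. *$\lambda$-column catabolizable*) if the first row of $T$ has at least $\lambda_1$ cells, its first $\lambda_1$ entries are the $\lambda_1$ smallest entries of $T$, and $\mathrm{Cat}_{\lambda_1}(T)$ is $\widehat\lambda$-catabolizable (resp. $\mathrm{CCat}_{\lambda_1}(T)$ is $\widehat\lambda$-column catabolizable); the empty tableau is $\varnothing$-(column) catabolizable.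 The *catabolizability* of $T$ is the largest partition $\lambda$ of $n$, in dominance order, such that $T$ is $\lambda$-catabolizable. The *column catabolizability* of $T$ is the sequence $(m_1,m_2,\dots)$ obtained by applying column catabolisms $\mathrm{CCat}_{m_1},\mathrm{CCat}_{m_2},\dots$ successively until the tableau is empty, where each $m_i$ is the largest $m$ such that the first $m$ cells of the first row of the current tableau contain its $m$ smallest entries. Then: 1. the catabolizability of $T$ exists, the column catabolizability of $T$ is a partition of $n$, and the two are equal; 2. for every partition $\lambda$ of $n$, $T$ is $\lambda$-catabolizable if and only if $T$ is $\lambda$-column catabolizable. -/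

import Mathlib

namespace Catabolism

/-- A (straight-shape) filling in English notation, as the list of its rows from top to bottom,
each row read from left to right. -/
abbrev Filling := List (List ℕ)

/-- Schensted row insertion of `x`: in the top row, `x` replaces the leftmost entry greater than
`x`, which is then inserted into the rows below; if there is none, `x` is put at the row's end. -/
def rowInsert (x : ℕ) : Filling → Filling
  | [] => [[x]]
  | r :: t =>
    if h : r.findIdx (fun y => decide (x < y)) < r.length then
      r.set (r.findIdx (fun y => decide (x < y))) x ::
        rowInsert (r[r.findIdx (fun y => decide (x < y))]) t
    else (r ++ [x]) :: t

/-- The insertion tableau `P(w)` of the word `w`. -/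
def insertionTableau (w : List ℕ) : Filling :=
  w.foldl (fun T x => rowInsert x T) []

/-- The row reading word: the rows are read from bottom to top, each from left to right.
It may also be applied to a piece of a tableau, some of whose rows are empty. -/
def rowWord (T : Filling) : List ℕ := T.reverse.flatten

/-- The first (top) row. -/
def firstRow (T : Filling) : List ℕ := T.headD []

/-- The `m`-catabolism `Cat_m(T) = P(T_n T_s)`: remove the first `m` cells of the first row; `T_n`
is what is left of the first row and `T_s` consists of the other rows. -/
def cat (m : ℕ) (T : Filling) : Filling :=
  insertionTableau ((firstRow T).drop m ++ rowWord T.tail)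

/-- The `m`-column catabolism `CCat_m(T) = P(T_e T_w)`: remove the first `m` cells of the first
row; `T_e` consists of the columns after the `m`-th one, and `T_w` of what is left of the first `m`
columns, that is of their cells below the first row. -/
def colCat (m : ℕ) (T : Filling) : Filling :=
  insertionTableau (rowWord (T.map (List.drop m)) ++ rowWord (T.tail.map (List.take m)))

/-- The first row of `T` has at least `m` cells, and its first `m` entries are the `m` smallest
entries of `T` (for `T` with distinct entries). -/
def HasSmallest (m : ℕ) (T : Filling) : Prop :=
  m ≤ (firstRow T).length ∧
    ∀ a ∈ (firstRow T).take m, ∀ b ∈ (firstRow T).drop m ++ T.tail.flatten, a < b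

instance (m : ℕ) (T : Filling) : Decidable (HasSmallest m T) :=
  inferInstanceAs (Decidable (_ ∧ _))

/-- `IsCatabolizable l T`: `T` is `l`-catabolizable, `l` being the list of the parts of a
partition in decreasing order. -/
def IsCatabolizable : List ℕ → Filling → Prop
  | [], T => T = []
  | m :: l, T => HasSmallest m T ∧ IsCatabolizable l (cat m T)

/-- `IsColCatabolizable l T`: `T` is `l`-column catabolizable. -/
def IsColCatabolizable : List ℕ → Filling → Prop
  | [], T => T = []
  | m :: l, T => HasSmallest m T ∧ IsColCatabolizable l (colCat m T)

/-- The largest `m` such that the first `m` cells of the first row hold the `m` smallest entries. -/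
def maxSmallest (T : Filling) : ℕ :=
  Nat.findGreatest (fun m => HasSmallest m T) (firstRow T).length

/-- The sequence of the numbers `m` when `CCat_m` is applied repeatedly, each time with the
largest `m` such that the first `m` cells of the first row hold the `m` smallest entries, until
the tableau is empty; at most `k` steps are made. -/
def greedyColCat : ℕ → Filling → List ℕ
  | 0, _ => []
  | _ + 1, [] => []
  | k + 1, r :: t =>
    maxSmallest (r :: t) :: greedyColCat k (colCat (maxSmallest (r :: t)) (r :: t))

/-- The column catabolizability of `T`: the sequence of the sizes of the greedy column
catabolisms. Every step removes at least one cell from a nonempty tableau, so the number of cells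
of `T` bounds the number of steps. -/
def colCatabolizability (T : Filling) : List ℕ := greedyColCat T.flatten.length T

/-- The parts of a partition in decreasing order. -/
def partList {n : ℕ} (ν : Nat.Partition n) : List ℕ := ν.parts.sort (· ≥ ·)

/-- `Dominates κ ν`: `κ` is at least `ν` in dominance order. -/
def Dominates {n : ℕ} (κ ν : Nat.Partition n) : Prop :=
  ∀ k : ℕ, ((partList ν).take k).sum ≤ ((partList κ).take k).sum

/-- The list of rows of a semistandard Young tableau. -/
def rows {μ : YoungDiagram} (T : SemistandardYoungTableau μ) : Filling :=
  (List.range (μ.colLen 0)).map fun i => (List.range (μ.rowLen i)).map fun j => T i j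

/-- `T` is a standard Young tableau: its entries are `1, …, n`, each occurring exactly once, `n`
being the number of cells. -/
def IsStandard {μ : YoungDiagram} (T : SemistandardYoungTableau μ) : Prop :=
  Set.BijOn (fun c : ℕ × ℕ => T c.1 c.2) (μ.cells : Set (ℕ × ℕ)) (Set.Icc 1 μ.card)

/-- `ν` is the catabolizability of `T`: the largest partition in dominance order (hence the unique
maximal one) among those `κ` for which `T` is `κ`-catabolizable. -/
def IsCatabolizability {μ : YoungDiagram} (T : SemistandardYoungTableau μ)
    (ν : Nat.Partition μ.card) : Prop :=
  IsCatabolizable (partList ν) (rows T) ∧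
    ∀ κ : Nat.Partition μ.card, IsCatabolizable (partList κ) (rows T) → Dominates ν κ

end Catabolism

/-! Both kinds of catabolizability are the same condition on the cocharge labels of the tableau. A
word drives an algorithm that fills a shape `c`: its letters are taken from the right; a letter `a`
adds a cell to row `a` if the result is still a partition inside `c`, and otherwise returns to the
left end of the word as `a + 1`. `Good` says that the word is eventually used up with the shape
filled.

The condition depends only on the Knuth class of the word (`Good.of_kEq`). Knuth equivalent words
without repetitions have the same cocharge labels, and their label words are again Knuth equivalent
(`isLab_iff_of_kEq`, `KEq.map_lab`), so inserting a word does no harm. The `m` smallest entries lie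
at the start of the first row exactly when at least `m` labels vanish (`hasSmallest_iff`). Removing
them and moving the part of the word behind them to the front changes the labels, up to a shift by
one row, just as the algorithm does when it rotates that part (`IsLab.rotate`, `map_rotLab`,
`good_shift`).

Hence `Cat_m` is what the algorithm does to the row reading word while it fills row zero with `m`
cells (`cat_step`). For `CCat_m` the reading word is replaced by the word of the first `m` columns
followed by that of the others (`rowWord_split`). The crux is that the whole right part may then be
rotated, although some of its letters might be addable (`good_rotate_right_part`, `colCat_step`).
This proves the second claim.

For the first claim, passing from `Cat_p` to `Cat_m` with `p ≤ m` costs at most `m - p` in every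
partial sum (`exists_isCatabolizable_cat`), so it is best to begin with the largest possible `m`;
the second claim then exchanges `Cat_m` for `CCat_m`, and induction applies. The greedy sizes
decrease weakly because, after a maximal column catabolism, the new zero labels come from the first
`m` cells of a single row (`HasSmallest.le_of_colCat`). -/

namespace Catabolism

/-! ### Knuth equivalence -/

/-- The elementary Knuth transformations. -/
inductive KStep : List ℕ → List ℕ → Prop
  | bac (u v : List ℕ) {a b c : ℕ} (h₁ : a < b) (h₂ : b ≤ c) :
      KStep (u ++ [b, a, c] ++ v) (u ++ [b, c, a] ++ v)
  | acb (u v : List ℕ) {a b c : ℕ} (h₁ : a ≤ b) (h₂ : b < c) :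
      KStep (u ++ [a, c, b] ++ v) (u ++ [c, a, b] ++ v)

/-- Knuth equivalence of words. -/
abbrev KEq : List ℕ → List ℕ → Prop := Relation.EqvGen KStep

theorem KEq.refl (w : List ℕ) : KEq w w := Relation.EqvGen.refl w

theorem KEq.symm {w w' : List ℕ} (h : KEq w w') : KEq w' w := Relation.EqvGen.symm _ _ h

theorem KEq.trans {w w' w'' : List ℕ} (h : KEq w w') (h' : KEq w' w'') : KEq w w'' :=
  Relation.EqvGen.trans _ _ _ h h'

theorem KStep.context {w w' : List ℕ} (h : KStep w w') (p s : List ℕ) :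
    KStep (p ++ w ++ s) (p ++ w' ++ s) := by
  cases h with
  | bac u v h₁ h₂ => simpa using KStep.bac (p ++ u) (v ++ s) h₁ h₂
  | acb u v h₁ h₂ => simpa using KStep.acb (p ++ u) (v ++ s) h₁ h₂

theorem KEq.context {w w' : List ℕ} (h : KEq w w') (p s : List ℕ) :
    KEq (p ++ w ++ s) (p ++ w' ++ s) := by
  induction h with
  | rel _ _ h => exact .rel _ _ (h.context p s)
  | refl => exact .refl _
  | symm _ _ _ ih => exact ih.symm
  | trans _ _ _ _ _ ih ih' => exact ih.trans ih'

theorem KEq.append_left {w w' : List ℕ} (p : List ℕ) (h : KEq w w') : KEq (p ++ w) (p ++ w') := by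
  simpa using h.context p []

theorem KEq.append_right {w w' : List ℕ} (h : KEq w w') (s : List ℕ) :
    KEq (w ++ s) (w' ++ s) := by
  simpa using h.context [] s

theorem KEq.cons {w w' : List ℕ} (a : ℕ) (h : KEq w w') : KEq (a :: w) (a :: w') := by
  simpa using h.append_left [a]

theorem KStep.perm {w w' : List ℕ} (h : KStep w w') : w.Perm w' := by
  cases h with
  | bac u v _ _ =>
    exact ((List.Perm.swap _ _ _).cons _ |>.append_left u).append_right v
  | acb u v _ _ =>
    exact ((List.Perm.swap _ _ _).append_left u).append_right v

theorem KEq.perm {w w' : List ℕ} (h : KEq w w') : w.Perm w' := by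
  induction h with
  | rel _ _ h => exact h.perm
  | refl => exact .refl _
  | symm _ _ _ ih => exact ih.symm
  | trans _ _ _ _ _ ih ih' => exact ih.trans ih'

/-- A small letter moves to the left through a weakly increasing word behind a larger letter. -/
theorem KEq.move_left {a b : ℕ} (hab : a < b) {s : List ℕ} (hs : (b :: s).Pairwise (· ≤ ·)) :
    KEq (b :: s ++ [a]) (b :: a :: s) := by
  induction s generalizing b with
  | nil => exact .refl _
  | cons c s ih =>
    rw [List.pairwise_cons] at hs
    have hbc := hs.1 c (by simp)
    have h1 := (ih (hab.trans_le hbc) hs.2).cons b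
    exact h1.trans (Relation.EqvGen.rel _ _ (KStep.bac [] s hab hbc)).symm

/-- A letter `y` moves to the left through a weakly increasing word of letters at most `x < y`
standing before `x`. -/
theorem KEq.move_left_of_le {x y : ℕ} (hxy : x < y) {u : List ℕ}
    (hs : (u ++ [x]).Pairwise (· ≤ ·)) : KEq (u ++ [y, x]) (y :: u ++ [x]) := by
  induction u using List.reverseRecOn generalizing x with
  | nil => exact .refl _
  | append_singleton u a ih =>
    have hax : a ≤ x := by
      rw [List.pairwise_append] at hs; exact hs.2.2 a (by simp) x (by simp)
    have h1 : KEq (u ++ [a] ++ [y, x]) (u ++ [y, a] ++ [x]) := by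
      simpa using (Relation.EqvGen.rel _ _ (KStep.acb u [] hax hxy))
    have h2 := ih (x := a) (by omega) (List.Pairwise.sublist (by simp) hs)
    simpa using h1.trans (h2.append_right [x])

/-! ### Row insertion -/

/-- Insertion of `x` into a row: the new row and the letter bumped, if any. -/
def rowBump (x : ℕ) : List ℕ → List ℕ × Option ℕ
  | [] => ([x], none)
  | y :: r => if x < y then (x :: r, some y) else (y :: (rowBump x r).1, (rowBump x r).2)

theorem rowInsert_nil (x : ℕ) : rowInsert x [] = [[x]] := by simp [rowInsert]

theorem rowInsert_cons (x : ℕ) (r : List ℕ) (t : Filling) :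
    rowInsert x (r :: t) =
      match (rowBump x r).2 with
      | none => (rowBump x r).1 :: t
      | some y => (rowBump x r).1 :: rowInsert y t := by
  rw [rowInsert]
  suffices h : (∀ h : r.findIdx (fun y => decide (x < y)) < r.length,
      rowBump x r = (r.set (r.findIdx (fun y => decide (x < y))) x,
        some (r[r.findIdx (fun y => decide (x < y))]))) ∧
      (¬ r.findIdx (fun y => decide (x < y)) < r.length → rowBump x r = (r ++ [x], none)) by
    split
    · rename_i h'
      rw [h.1 h']
    · rename_i h'
      rw [h.2 h']
  clear t
  induction r with
  | nil => simp [rowBump]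
  | cons y r ih =>
    by_cases hxy : x < y
    · simp [rowBump, hxy, List.findIdx_cons]
    · refine ⟨fun h => ?_, fun h => ?_⟩
      · have hf : (y :: r).findIdx (fun y => decide (x < y)) =
            r.findIdx (fun y => decide (x < y)) + 1 := by simp [List.findIdx_cons, hxy]
        have h' : r.findIdx (fun y => decide (x < y)) < r.length := by
          rw [hf] at h; simpa using h
        have := ih.1 h'
        simp [rowBump, hxy, this, hf]
      · have hf : (y :: r).findIdx (fun y => decide (x < y)) =
            r.findIdx (fun y => decide (x < y)) + 1 := by simp [List.findIdx_cons, hxy]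
        have h' : ¬ r.findIdx (fun y => decide (x < y)) < r.length := by
          rw [hf] at h; simpa using h
        have := ih.2 h'
        simp [rowBump, hxy, this]

theorem rowBump_eq {x : ℕ} {r : List ℕ} (hr : r.Pairwise (· ≤ ·)) :
    (rowBump x r = (r ++ [x], none) ∧ ∀ u ∈ r, u ≤ x) ∨
      ∃ u y v, r = u ++ y :: v ∧ x < y ∧ (∀ a ∈ u, a ≤ x) ∧
        rowBump x r = (u ++ x :: v, some y) := by
  induction r with
  | nil => simp [rowBump]
  | cons a r ih =>
    rw [List.pairwise_cons] at hr
    by_cases h : x < a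
    · exact Or.inr ⟨[], a, r, by simp [rowBump, h]⟩
    · rcases ih hr.2 with ⟨h1, h2⟩ | ⟨u, y, v, rfl, h1, h2, h3⟩
      · left
        simp only [rowBump, h, if_false, h1]
        simp only [List.cons_append, true_and, List.mem_cons, forall_eq_or_imp]
        exact ⟨by omega, h2⟩
      · right
        refine ⟨a :: u, y, v, rfl, h1, ?_, ?_⟩
        · simp only [List.mem_cons, forall_eq_or_imp]
          exact ⟨by omega, h2⟩
        · simp [rowBump, h, h3]

/-- The row `r` may stand directly above the row `s` in a tableau. -/
def Above : List ℕ → List ℕ → Prop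
  | _, [] => True
  | [], _ :: _ => False
  | a :: r, b :: s => a < b ∧ Above r s

@[simp] theorem above_nil (r : List ℕ) : Above r [] := by cases r <;> trivial

@[simp] theorem above_cons {a b : ℕ} {r s : List ℕ} :
    Above (a :: r) (b :: s) ↔ a < b ∧ Above r s := Iff.rfl

@[simp] theorem not_nil_above {b : ℕ} {s : List ℕ} : ¬ Above [] (b :: s) := id

/-- Semistandard tableaux: nonempty weakly increasing rows, strictly increasing columns. -/
def IsTab : Filling → Prop
  | [] => True
  | r :: t => r ≠ [] ∧ r.Pairwise (· ≤ ·) ∧ Above r (firstRow t) ∧ IsTab t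

theorem Above.rowBump_left {r s : List ℕ} (x : ℕ) (h : Above r s) :
    Above (rowBump x r).1 s := by
  induction r generalizing s with
  | nil => cases s <;> simp_all
  | cons a r ih =>
    cases s with
    | nil => simp
    | cons b s =>
      simp only [above_cons] at h
      simp only [rowBump]
      split
      · simp only [above_cons]; exact ⟨by omega, h.2⟩
      · simp only [above_cons]; exact ⟨h.1, ih h.2⟩

theorem rowBump_snd_mem {x y : ℕ} {r : List ℕ} (h : (rowBump x r).2 = some y) :
    y ∈ r ∧ x < y := by
  induction r with
  | nil => simp [rowBump] at h
  | cons a r ih =>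
    simp only [rowBump] at h
    split at h
    · simp at h; subst h; simp_all
    · have := ih h; simp [this]

/-- The entry below `y`, if any, exceeds `y`, so `y` lands in `s` at its old column or further left.
The new row above has entries at most `x < y` there. -/
theorem Above.rowBump_both {r s : List ℕ} {x y : ℕ} (h : Above r s) (hr : r.Pairwise (· ≤ ·))
    (hb : (rowBump x r).2 = some y) : Above (rowBump x r).1 (rowBump y s).1 := by
  induction r generalizing s with
  | nil => simp [rowBump] at hb
  | cons a r ih =>
    rw [List.pairwise_cons] at hr
    by_cases hxa : x < a
    · have hy : y = a := by simpa [rowBump, hxa] using hb.symm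
      subst hy
      cases s with
      | nil => simp [rowBump, hxa]
      | cons b s =>
        simp only [above_cons] at h
        simp [rowBump, hxa, h]
    · have hb' : (rowBump x r).2 = some y := by simpa [rowBump, hxa] using hb
      have hy := rowBump_snd_mem hb'
      cases s with
      | nil => simp only [rowBump, hxa, if_false, above_cons, above_nil, and_true]; omega
      | cons b s =>
        simp only [above_cons] at h
        by_cases hyb : y < b
        · simp only [rowBump, hxa, hyb, if_false, if_true, above_cons]
          exact ⟨by omega, h.2.rowBump_left x⟩
        · simp only [rowBump, hxa, hyb, if_false, above_cons]
          exact ⟨h.1, ih h.2 hr.2 hb'⟩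

theorem rowBump_sorted {x : ℕ} {r : List ℕ} (hr : r.Pairwise (· ≤ ·)) :
    (rowBump x r).1.Pairwise (· ≤ ·) := by
  rcases rowBump_eq (x := x) hr with ⟨h, h'⟩ | ⟨u, y, v, rfl, h1, h2, h3⟩
  · rw [h, List.pairwise_append]; simpa using ⟨hr, h'⟩
  · rw [h3]
    simp only [List.pairwise_append, List.pairwise_cons, List.mem_cons, forall_eq_or_imp] at hr ⊢
    refine ⟨hr.1, ⟨fun a ha => ?_, hr.2.1.2⟩, fun a ha => ⟨h2 a ha, (hr.2.2 a ha).2⟩⟩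
    have := hr.2.1.1 a ha
    omega

theorem rowBump_fst_ne_nil (x : ℕ) (r : List ℕ) : (rowBump x r).1 ≠ [] := by
  cases r <;> simp only [rowBump]
  · simp
  · split <;> simp

theorem firstRow_rowInsert (x : ℕ) (T : Filling) :
    firstRow (rowInsert x T) = (rowBump x (firstRow T)).1 := by
  cases T with
  | nil => simp [rowInsert_nil, firstRow, rowBump]
  | cons r t =>
    rw [rowInsert_cons]
    split <;> rfl

theorem IsTab.rowInsert {T : Filling} (x : ℕ) (hT : IsTab T) : IsTab (rowInsert x T) := by
  induction T generalizing x with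
  | nil => simp [rowInsert_nil, IsTab, firstRow]
  | cons r t ih =>
    obtain ⟨h0, h1, h2, h3⟩ := hT
    rw [rowInsert_cons]
    split
    · exact ⟨rowBump_fst_ne_nil _ _, rowBump_sorted h1, h2.rowBump_left x, h3⟩
    · rename_i y hy
      refine ⟨rowBump_fst_ne_nil _ _, rowBump_sorted h1, ?_, ih y h3⟩
      rw [firstRow_rowInsert]
      exact h2.rowBump_both h1 hy

@[simp] theorem rowWord_nil : rowWord [] = [] := rfl

@[simp] theorem rowWord_cons (r : List ℕ) (t : Filling) : rowWord (r :: t) = rowWord t ++ r := by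
  simp [rowWord]

/-- If `x` bumps `y` from the row `u y v`, then `u y v x` becomes `u y x v` and then `y u x v`: the
bumped letter ends up in front of the row, ready for insertion into the rows below. -/
theorem rowWord_rowInsert {T : Filling} (x : ℕ) (hT : IsTab T) :
    KEq (rowWord (rowInsert x T)) (rowWord T ++ [x]) := by
  induction T generalizing x with
  | nil => simpa [rowInsert_nil] using KEq.refl [x]
  | cons r t ih =>
    obtain ⟨h0, h1, h2, h3⟩ := hT
    rw [rowInsert_cons]
    rcases rowBump_eq (x := x) h1 with ⟨h, h'⟩ | ⟨u, y, v, rfl, hxy, hu, h⟩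
    · rw [h]; simpa using KEq.refl _
    · rw [h]
      simp only [rowWord_cons]
      refine ((ih y h3).append_right _).trans ?_
      have hs := h1
      simp only [List.pairwise_append, List.pairwise_cons, List.mem_cons, forall_eq_or_imp] at hs
      have e1 : KEq (y :: v ++ [x]) (y :: x :: v) :=
        KEq.move_left hxy (List.pairwise_cons.2 hs.2.1)
      have e2 : KEq (u ++ [y, x]) (y :: u ++ [x]) := by
        refine KEq.move_left_of_le hxy ?_
        rw [List.pairwise_append]
        simpa using ⟨hs.1, hu⟩
      have e3 := ((e1.append_left u).trans (by simpa using e2.append_right v)).symm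
      simpa using e3.append_left (rowWord t)

theorem insertionTableau_append_singleton (w : List ℕ) (x : ℕ) :
    insertionTableau (w ++ [x]) = rowInsert x (insertionTableau w) := by
  simp [insertionTableau]

theorem isTab_insertionTableau (w : List ℕ) : IsTab (insertionTableau w) := by
  induction w using List.reverseRecOn with
  | nil => trivial
  | append_singleton w x ih => rw [insertionTableau_append_singleton]; exact ih.rowInsert x

theorem rowWord_insertionTableau (w : List ℕ) : KEq (rowWord (insertionTableau w)) w := by
  induction w using List.reverseRecOn with
  | nil => exact .refl _
  | append_singleton w x ih =>
    rw [insertionTableau_append_singleton]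
    exact (rowWord_rowInsert x (isTab_insertionTableau w)).trans (ih.append_right [x])

/-! ### Splitting a tableau along a vertical line -/

theorem Above.length_le {r s : List ℕ} (h : Above r s) : s.length ≤ r.length := by
  induction r generalizing s with
  | nil => cases s <;> simp_all
  | cons a r ih => cases s with
    | nil => simp
    | cons b s => simpa using ih h.2

theorem Above.take {r s : List ℕ} (n : ℕ) (h : Above r s) : Above (r.take n) (s.take n) := by
  induction r generalizing s n with
  | nil => cases s <;> simp_all
  | cons a r ih => cases s with
    | nil => simp
    | cons b s => cases n with
      | zero => simp
      | succ n => simpa using ⟨h.1, ih n h.2⟩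

theorem Above.drop {r s : List ℕ} (n : ℕ) (h : Above r s) : Above (r.drop n) (s.drop n) := by
  induction r generalizing s n with
  | nil => cases s <;> simp_all
  | cons a r ih => cases s with
    | nil => simp
    | cons b s => cases n with
      | zero => simpa using h
      | succ n => simpa using ih n h.2

theorem Above.exists_lt_of_length_eq {r s : List ℕ} (h : Above r s) (hl : r.length = s.length)
    {a : ℕ} (ha : a ∈ r) : ∃ b ∈ s, a < b := by
  induction r generalizing s with
  | nil => simp at ha
  | cons x r ih => cases s with
    | nil => simp at hl
    | cons b s =>
      rcases List.mem_cons.1 ha with rfl | ha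
      · exact ⟨b, by simp, h.1⟩
      · obtain ⟨c, hc, hac⟩ := ih h.2 (by simpa using hl) ha
        exact ⟨c, by simp [hc], hac⟩

theorem Above.exists_lt {r s : List ℕ} (h : Above r s) {b : ℕ} (hb : b ∈ s) :
    ∃ a ∈ r, a < b := by
  induction r generalizing s with
  | nil => cases s <;> simp_all
  | cons x r ih => cases s with
    | nil => simp at hb
    | cons c s =>
      rcases List.mem_cons.1 hb with rfl | hb
      · exact ⟨x, by simp, h.1⟩
      · obtain ⟨a, ha, hab⟩ := ih h.2 hb
        exact ⟨a, by simp [ha], hab⟩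

/-- The first letter `a` of `r` can cross the whole row `b l p` up to `b`, since `a < b`. Once the
remaining letters of `r` have crossed `p`, it moves back across `l` alone. -/
theorem KEq.swap_row {l r p : List ℕ} (hl : (l ++ p).Pairwise (· ≤ ·)) (h : Above r l)
    (hlen : r.length = l.length) : KEq (l ++ (p ++ r)) (l ++ (r ++ p)) := by
  induction l generalizing r with
  | nil =>
    have : r = [] := by simpa using hlen
    subst this; simpa using KEq.refl p
  | cons b l ih => cases r with
    | nil => simp at hlen
    | cons a r =>
      have hl' : (l ++ p).Pairwise (· ≤ ·) := List.Pairwise.of_cons (by simpa using hl)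
      have e1 : KEq (b :: (l ++ p) ++ [a]) (b :: a :: (l ++ p)) := KEq.move_left h.1 hl
      have e2 : KEq (b :: l ++ [a]) (b :: a :: l) :=
        KEq.move_left h.1 (List.Pairwise.sublist (by simp) hl)
      have e3 := ((ih hl' h.2 (by simpa using hlen)).cons a).cons b
      have e4 := (by simpa using e1.append_right r : KEq _ _).trans e3
      simpa using e4.trans (by simpa using e2.symm.append_right (r ++ p))

theorem KEq.swap_rows {l p : List ℕ} {B : List (List ℕ)} (hl : (l ++ p).Pairwise (· ≤ ·))
    (hB : (l :: B).IsChain fun s r => Above r s ∧ r.length = s.length ∧ r.Pairwise (· ≤ ·)) :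
    KEq (l ++ (p ++ B.flatten)) (l ++ (B.flatten ++ p)) := by
  induction B generalizing l with
  | nil => simpa using KEq.refl _
  | cons d B ih =>
    rw [List.isChain_cons_cons] at hB
    obtain ⟨⟨h1, h2, h3⟩, h4⟩ := hB
    have hd : (d ++ p).Pairwise (· ≤ ·) := by
      rw [List.pairwise_append] at hl ⊢
      refine ⟨h3, hl.2.1, fun a ha b hb => ?_⟩
      obtain ⟨c, hc, hac⟩ := h1.exists_lt_of_length_eq h2 ha
      exact hac.le.trans (hl.2.2 c hc b hb)
    have e1 := (KEq.swap_row hl h1 h2).append_right B.flatten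
    have e2 := (ih hd h4).append_left l
    simpa using (by simpa using e1 : KEq _ _).trans e2

/-- `D` lists, upwards, rows standing above `U`. The right part of the top row `q` crosses `D`
behind the left part of `q`; the right parts of the lower rows cross with `q` counted among the rows
above. If `q` is wider than `n`, the left parts of all rows above have exactly `n` cells, as
`KEq.swap_rows` requires; otherwise `q` has no right part. -/
theorem KEq.swap_right_part (n : ℕ) {U D : Filling} (hU : IsTab U)
    (hD : ∀ r ∈ D, r.Pairwise (· ≤ ·))
    (hc : (firstRow U :: D).IsChain fun s r => Above r s) :
    KEq (rowWord (U.map (List.take n)) ++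
        (rowWord (U.map (List.drop n)) ++ (D.map (List.take n)).flatten))
      (rowWord (U.map (List.take n)) ++
        ((D.map (List.take n)).flatten ++ rowWord (U.map (List.drop n)))) := by
  induction U generalizing D with
  | nil => simpa using KEq.refl _
  | cons q U ih =>
    obtain ⟨-, h1, h2, h3⟩ := hU
    simp only [firstRow, List.headD_cons] at hc
    have e1 := ih h3 (D := [q]) (by simpa using h1) (by simpa using h2)
    have e2 := ih h3 (D := q :: D) (by simpa using ⟨h1, hD⟩)
      (List.isChain_cons_cons.2 ⟨h2, hc⟩)
    have e3 : KEq (q.take n ++ (q.drop n ++ (D.map (List.take n)).flatten))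
        (q.take n ++ ((D.map (List.take n)).flatten ++ q.drop n)) := by
      by_cases hq : q.length ≤ n
      · rw [List.drop_of_length_le hq]; simpa using KEq.refl _
      · refine KEq.swap_rows (by simpa using h1) ?_
        clear e1 e2 ih h1 h2
        induction D generalizing q with
        | nil => simp
        | cons d D ihD =>
          rw [List.isChain_cons_cons] at hc
          simp only [List.mem_cons, forall_eq_or_imp] at hD
          have hlen := hc.1.length_le
          refine List.isChain_cons_cons.2 ⟨⟨hc.1.take n, ?_, hD.1.sublist (List.take_sublist _ _)⟩,
            ihD d hD.2 hc.2 (by omega)⟩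
          simp only [List.length_take]; omega
    simp only [List.map_cons, rowWord_cons, List.map_nil, List.flatten_cons, List.flatten_nil,
      List.append_nil, List.append_assoc] at e1 e2 ⊢
    have f1 := (e1.append_right (q.drop n ++ (D.map (List.take n)).flatten)).symm
    have f2 := e3.append_left (rowWord (U.map (List.take n)) ++ rowWord (U.map (List.drop n)))
    have f3 := e2.append_right (q.drop n)
    simp only [List.append_assoc] at f1 f2 f3
    exact f1.trans (f2.trans f3)

/-- The row reading word is Knuth equivalent to that of the first `n` columns followed by that of
the other columns. -/
theorem rowWord_split (n : ℕ) {U : Filling} (hU : IsTab U) :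
    KEq (rowWord U) (rowWord (U.map (List.take n)) ++ rowWord (U.map (List.drop n))) := by
  induction U with
  | nil => exact .refl _
  | cons q U ih =>
    obtain ⟨-, h1, h2, h3⟩ := hU
    have e1 := KEq.swap_right_part n h3 (D := [q]) (by simpa using h1) (by simpa using h2)
    have e2 := (ih h3).append_right q
    have e3 := e1.append_right (q.drop n)
    simp only [List.map_cons, rowWord_cons, List.map_nil, List.flatten_cons, List.flatten_nil,
      List.append_nil, List.append_assoc, List.take_append_drop] at e1 e2 e3 ⊢
    exact e2.trans e3

/-! ### The insertion algorithm for catabolizability -/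

/-- The row `a` of `κ` may be extended by a cell, inside `c`. -/
def Addable (c κ : ℕ → ℕ) (a : ℕ) : Prop := κ a < c a ∧ (a = 0 ∨ κ a < κ (a - 1))

instance (c κ : ℕ → ℕ) (a : ℕ) : Decidable (Addable c κ a) :=
  inferInstanceAs (Decidable (_ ∧ _))

/-- `κ` with a cell added in row `a`. -/
def addCell (κ : ℕ → ℕ) (a : ℕ) : ℕ → ℕ := Function.update κ a (κ a + 1)

/-- The queue `x` of row indices fills the shape `c` exactly, starting from `κ`, in at most `n`
steps: the first letter `a` adds a cell in row `a` if possible, else it goes to the end of the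
queue as `a + 1`. -/
def Fills (c : ℕ → ℕ) : ℕ → List ℕ → (ℕ → ℕ) → Prop
  | _, [], κ => κ = c
  | 0, _ :: _, _ => False
  | n + 1, a :: x, κ =>
    if Addable c κ a then Fills c n x (addCell κ a) else Fills c n (x ++ [a + 1]) κ

/-- The local transformations of queues which do not affect the algorithm. -/
inductive Local (c κ : ℕ → ℕ) : List ℕ → List ℕ → Prop
  | comm (u v : List ℕ) {p q : ℕ} (h : p + 2 ≤ q ∨ q + 2 ≤ p) :
      Local c κ (u ++ p :: q :: v) (u ++ q :: p :: v)
  | full (u v : List ℕ) {p q : ℕ} (h : q = p + 1 ∧ c p ≤ κ p ∨ p = q + 1 ∧ c q ≤ κ q) :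
      Local c κ (u ++ p :: q :: v) (u ++ q :: p :: v)
  | cac (u v : List ℕ) (a : ℕ) :
      Local c κ (u ++ (a + 1) :: a :: (a + 1) :: v) (u ++ a :: (a + 1) :: (a + 1) :: v)
  | acc (u v : List ℕ) (a : ℕ) :
      Local c κ (u ++ a :: (a + 1) :: (a + 1) :: v) (u ++ (a + 1) :: a :: (a + 1) :: v)
  | aca (u v : List ℕ) (a : ℕ) :
      Local c κ (u ++ a :: (a + 1) :: a :: v) (u ++ a :: a :: (a + 1) :: v)
  | aac (u v : List ℕ) (a : ℕ) :
      Local c κ (u ++ a :: a :: (a + 1) :: v) (u ++ a :: (a + 1) :: a :: v)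

theorem le_addCell (κ : ℕ → ℕ) (a b : ℕ) : κ b ≤ addCell κ a b := by
  unfold addCell Function.update; split
  · rename_i h; subst h; simp
  · simp

theorem addCell_comm (κ : ℕ → ℕ) (a b : ℕ) :
    addCell (addCell κ a) b = addCell (addCell κ b) a := by
  ext i; unfold addCell Function.update; grind

theorem addable_addCell_of_ne {c κ : ℕ → ℕ} {a b : ℕ} (h1 : b ≠ a) (h2 : b ≠ a + 1) :
    Addable c (addCell κ a) b ↔ Addable c κ b := by
  unfold Addable addCell Function.update
  grind

theorem addable_addCell_self {c κ : ℕ → ℕ} {a : ℕ} :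
    Addable c (addCell κ a) a ↔ κ a + 1 < c a ∧ (a = 0 ∨ κ a + 1 < κ (a - 1)) := by
  unfold Addable addCell Function.update
  grind

theorem addable_addCell_succ {c κ : ℕ → ℕ} {a : ℕ} :
    Addable c (addCell κ a) (a + 1) ↔ κ (a + 1) < c (a + 1) ∧ κ (a + 1) < κ a + 1 := by
  unfold Addable addCell Function.update
  grind

theorem not_addable_of_le {c κ : ℕ → ℕ} {a : ℕ} (h : c a ≤ κ a) : ¬ Addable c κ a :=
  fun h' => absurd h'.1 (by omega)

theorem Local.addCell {c κ : ℕ → ℕ} {x y : List ℕ} (h : Local c κ x y) (a : ℕ) :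
    Local c (addCell κ a) x y := by
  cases h with
  | comm u v h => exact .comm u v h
  | full u v h =>
    refine .full u v (h.imp (fun h => ⟨h.1, h.2.trans (le_addCell _ _ _)⟩)
      (fun h => ⟨h.1, h.2.trans (le_addCell _ _ _)⟩))
  | cac u v a => exact .cac u v a
  | acc u v a => exact .acc u v a
  | aca u v a => exact .aca u v a
  | aac u v a => exact .aac u v a

theorem Local.append {c κ : ℕ → ℕ} {x y : List ℕ} (h : Local c κ x y) (s : List ℕ) :
    Local c κ (x ++ s) (y ++ s) := by
  cases h with
  | comm u v h => simpa using Local.comm u (v ++ s) h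
  | full u v h => simpa using Local.full u (v ++ s) h
  | cac u v a => simpa using Local.cac u (v ++ s) a
  | acc u v a => simpa using Local.acc u (v ++ s) a
  | aca u v a => simpa using Local.aca u (v ++ s) a
  | aac u v a => simpa using Local.aac u (v ++ s) a

theorem Addable.antitone {c κ : ℕ → ℕ} {a : ℕ} (h : Addable c κ a) (hκ : Antitone κ) :
    Antitone (Catabolism.addCell κ a) := by
  refine antitone_nat_of_succ_le fun i => ?_
  have h1 := hκ (Nat.le_succ i)
  have h2 := h.2
  simp only [Catabolism.addCell, Function.update, Nat.succ_eq_add_one] at h1 ⊢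
  by_cases h3 : i + 1 = a
  · subst h3; simp at h2 ⊢; omega
  · by_cases h4 : i = a
    · subst h4; simp; omega
    · simp [h3, h4, h1]

/-! ### Local moves at the front of the queue -/

section LocalInvariance

variable {c : ℕ → ℕ} {n : ℕ} {κ : ℕ → ℕ}

theorem Fills.comm (hκ : Antitone κ)
    (ih : ∀ x y κ, Antitone κ → Local c κ x y → Fills c n x κ → Fills c n y κ)
    {p q : ℕ} {v : List ℕ} (h : p + 2 ≤ q ∨ q + 2 ≤ p) (hf : Fills c (n + 2) (p :: q :: v) κ) :
    Fills c (n + 2) (q :: p :: v) κ := by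
  have h1 : Addable c (addCell κ p) q ↔ Addable c κ q := addable_addCell_of_ne (by omega) (by omega)
  have h2 : Addable c (addCell κ q) p ↔ Addable c κ p := addable_addCell_of_ne (by omega) (by omega)
  by_cases hp : Addable c κ p <;> by_cases hq : Addable c κ q <;>
    simp only [Fills, hp, hq, h1, h2, if_true, if_false, List.cons_append, List.append_assoc,
      List.nil_append] at hf ⊢
  · rwa [addCell_comm]
  · exact hf
  · exact hf
  · exact ih _ _ _ hκ (.comm _ [] (by omega)) hf

/-- Row `p` being full, `p` is rotated in either order. If `p + 1` is rotated too, row `p + 1` is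
full as well, because row `p` does not obstruct it; so the letters `p + 1` and `p + 2` at the end
again differ by a move of the same kind. -/
theorem Fills.full_left (hc : Antitone c)
    (hκ : Antitone κ)
    (ih : ∀ x y κ, Antitone κ → Local c κ x y → Fills c n x κ → Fills c n y κ)
    {p : ℕ} {v : List ℕ} (h : c p ≤ κ p) (hf : Fills c (n + 2) (p :: (p + 1) :: v) κ) :
    Fills c (n + 2) ((p + 1) :: p :: v) κ := by
  have hp := not_addable_of_le h
  have hp' : ¬ Addable c (Catabolism.addCell κ (p + 1)) p :=
    not_addable_of_le (h.trans (le_addCell _ _ _))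
  by_cases hq : Addable c κ (p + 1) <;>
    simp only [Fills, hp, hp', hq, if_true, if_false, List.cons_append, List.append_assoc,
      List.nil_append] at hf ⊢
  · exact hf
  · refine ih _ _ _ hκ (.full _ [] (Or.inl ⟨rfl, ?_⟩)) hf
    have := hc (Nat.le_succ p)
    simp only [Addable, Nat.add_eq_zero_iff, one_ne_zero, and_false, false_or,
      Nat.add_sub_cancel, Nat.succ_eq_add_one] at hq this
    by_contra h''
    exact hq ⟨by omega, by omega⟩

theorem Fills.full_right (hc : Antitone c)
    (hκ : Antitone κ)
    (ih : ∀ x y κ, Antitone κ → Local c κ x y → Fills c n x κ → Fills c n y κ)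
    {p : ℕ} {v : List ℕ} (h : c p ≤ κ p) (hf : Fills c (n + 2) ((p + 1) :: p :: v) κ) :
    Fills c (n + 2) (p :: (p + 1) :: v) κ := by
  have hp := not_addable_of_le h
  have hp' : ¬ Addable c (Catabolism.addCell κ (p + 1)) p :=
    not_addable_of_le (h.trans (le_addCell _ _ _))
  by_cases hq : Addable c κ (p + 1) <;>
    simp only [Fills, hp, hp', hq, if_true, if_false, List.cons_append, List.append_assoc,
      List.nil_append] at hf ⊢
  · exact hf
  · refine ih _ _ _ hκ (.full _ [] (Or.inr ⟨rfl, ?_⟩)) hf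
    have := hc (Nat.le_succ p)
    simp only [Addable, Nat.add_eq_zero_iff, one_ne_zero, and_false, false_or,
      Nat.add_sub_cancel, Nat.succ_eq_add_one] at hq this
    by_contra h''
    exact hq ⟨by omega, by omega⟩

/-- The delicate case is that `a` can be added and `a + 1` cannot. If adding `a` makes room in row
`a + 1`, it makes room for one cell only, so exactly one of the two letters `a + 1` is rotated in
both orders. -/
theorem Fills.cac_iff (hκ : Antitone κ)
    (ih : ∀ x y κ, Antitone κ → Local c κ x y → Fills c n x κ → Fills c n y κ)
    {a : ℕ} {v : List ℕ} :
    Fills c (n + 3) ((a + 1) :: a :: (a + 1) :: v) κ ↔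
      Fills c (n + 3) (a :: (a + 1) :: (a + 1) :: v) κ := by
  have h1 : Addable c (Catabolism.addCell κ (a + 1)) a ↔ Addable c κ a :=
    addable_addCell_of_ne (by omega) (by omega)
  have h2 := addable_addCell_succ (c := c) (κ := κ) (a := a)
  have hcomm := addCell_comm κ a (a + 1)
  by_cases ha : Addable c κ a <;> by_cases hb : Addable c κ (a + 1)
  · have hb' : Addable c (Catabolism.addCell κ a) (a + 1) := by
      rw [h2]; have := hb; simp [Addable] at this; omega
    simp only [Fills, h1, ha, hb, hb', if_true, hcomm]
  · by_cases hb' : Addable c (Catabolism.addCell κ a) (a + 1)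
    · have hb'' : ¬ Addable c (Catabolism.addCell (Catabolism.addCell κ a) (a + 1)) (a + 1) := by
        rw [addable_addCell_self]
        rw [h2] at hb'
        simp only [Addable] at hb
        simp [Catabolism.addCell, Function.update] at hb ⊢
        omega
      simp only [Fills, ha, hb, hb', hb'', if_true, if_false, List.cons_append]
    · simp only [Fills, ha, hb, hb', if_true, if_false, List.cons_append]
  · simp only [Fills, h1, ha, hb, if_true, if_false, List.cons_append]
  · simp only [Fills, ha, hb, if_false, List.cons_append, List.append_assoc, List.nil_append]
    exact ⟨ih _ _ _ hκ (.cac v [] (a + 1)), ih _ _ _ hκ (.acc v [] (a + 1))⟩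

theorem Fills.aca_iff (hκ : Antitone κ)
    (ih : ∀ x y κ, Antitone κ → Local c κ x y → Fills c n x κ → Fills c n y κ)
    {a : ℕ} {v : List ℕ} :
    Fills c (n + 3) (a :: (a + 1) :: a :: v) κ ↔
      Fills c (n + 3) (a :: a :: (a + 1) :: v) κ := by
  have h1 : Addable c (Catabolism.addCell κ (a + 1)) a ↔ Addable c κ a :=
    addable_addCell_of_ne (by omega) (by omega)
  have h1' : Addable c (Catabolism.addCell (Catabolism.addCell κ a) (a + 1)) a ↔
      Addable c (Catabolism.addCell κ a) a :=
    addable_addCell_of_ne (by omega) (by omega)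
  have h2 := addable_addCell_succ (c := c) (κ := κ) (a := a)
  by_cases ha : Addable c κ a
  · by_cases ha' : Addable c (Catabolism.addCell κ a) a
    · have h3 : Addable c (Catabolism.addCell (Catabolism.addCell κ a) a) (a + 1) ↔
          Addable c (Catabolism.addCell κ a) (a + 1) := by
        rw [addable_addCell_succ, h2]
        have := hκ (Nat.le_succ a)
        simp only [Catabolism.addCell, Function.update, Nat.succ_eq_add_one] at this ⊢
        simp only [Nat.add_eq_left, one_ne_zero, dite_false, dite_true]
        omega
      by_cases hb' : Addable c (Catabolism.addCell κ a) (a + 1) <;>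
        simp only [Fills, h1', h3, ha, ha', hb', if_true, if_false, List.cons_append,
          addCell_comm (Catabolism.addCell κ a) a (a + 1)]
    · by_cases hb' : Addable c (Catabolism.addCell κ a) (a + 1)
      · simp only [Fills, h1', ha, ha', hb', if_true, if_false, List.cons_append]
      · simp only [Fills, ha, ha', hb', if_true, if_false, List.cons_append, List.append_assoc,
          List.nil_append]
        -- After one `a` is added, both other letters are rotated, in different orders. Row `a + 1`
        -- cannot be blocked by row `a`, which is now longer, so it is full. This is what forces the
        -- moves `Local.full` into the list.
        have hfull : c (a + 1) ≤ Catabolism.addCell κ a (a + 1) := by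
          rw [h2] at hb'
          have := hκ (Nat.le_succ a)
          simp only [Catabolism.addCell, Function.update, Nat.succ_eq_add_one] at this ⊢
          simp only [Nat.add_eq_left, one_ne_zero, dif_neg, not_false_eq_true]
          omega
        exact ⟨ih _ _ _ (ha.antitone hκ) (.full v [] (Or.inr ⟨rfl, hfull⟩)),
          ih _ _ _ (ha.antitone hκ) (.full v [] (Or.inl ⟨rfl, hfull⟩))⟩
  · by_cases hb : Addable c κ (a + 1)
    · simp only [Fills, h1, ha, hb, if_true, if_false, List.cons_append]
    · simp only [Fills, ha, hb, if_false, List.cons_append, List.append_assoc, List.nil_append]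
      exact ⟨ih _ _ _ hκ (.aca v [] (a + 1)), ih _ _ _ hκ (.aac v [] (a + 1))⟩

end LocalInvariance

/-- Induction on the number of steps, which is the same on both sides. A move behind the first
letter survives the processing of that letter, since full rows stay full. At the front, processing
the letters concerned on both sides gives the same state, with queues that agree or differ by a
local move at the end. -/
theorem Fills.of_local {c : ℕ → ℕ} (hc : Antitone c) {n : ℕ} {x y : List ℕ} {κ : ℕ → ℕ}
    (hκ : Antitone κ) (hl : Local c κ x y) (hf : Fills c n x κ) : Fills c n y κ := by
  induction n using Nat.strong_induction_on generalizing x y κ with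
  | _ n ih =>
    have key : ∀ (b : ℕ) (x y : List ℕ), Local c κ x y → Fills c n (b :: x) κ →
        Fills c n (b :: y) κ := by
      intro b x y hl hf
      cases n with
      | zero => simp [Fills] at hf
      | succ k =>
        simp only [Fills] at hf ⊢
        split
        · rename_i h
          rw [if_pos h] at hf
          exact ih k (by omega) (h.antitone hκ) (hl.addCell b) hf
        · rename_i h
          rw [if_neg h] at hf
          exact ih k (by omega) hκ (hl.append _) hf
    have ih' : ∀ k, k < n → ∀ x y κ, Antitone κ → Local c κ x y → Fills c k x κ → Fills c k y κ :=
      fun k hk x y κ h1 h2 h3 => ih k hk h1 h2 h3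
    have two : ∀ {p q : ℕ} {v : List ℕ}, Fills c n (p :: q :: v) κ → ∃ k, n = k + 2 := by
      intro p q v h
      match n, h with
      | 0, h => simp [Fills] at h
      | 1, h => simp [Fills] at h
      | k + 2, _ => exact ⟨k, rfl⟩
    have three : ∀ {p q r : ℕ} {v : List ℕ}, Fills c n (p :: q :: r :: v) κ →
        ∃ k, n = k + 3 := by
      intro p q r v h
      match n, h with
      | 0, h => simp [Fills] at h
      | 1, h => simp [Fills] at h
      | 2, h => simp [Fills] at h
      | k + 3, _ => exact ⟨k, rfl⟩
    cases hl with
    | comm u v h =>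
      cases u with
      | cons b u => exact key b _ _ (.comm u v h) hf
      | nil =>
        obtain ⟨k, rfl⟩ := two hf
        exact hf.comm hκ (ih' k (by omega)) h
    | full u v h =>
      cases u with
      | cons b u => exact key b _ _ (.full u v h) hf
      | nil =>
        obtain ⟨k, rfl⟩ := two hf
        rcases h with ⟨rfl, h⟩ | ⟨rfl, h⟩
        · exact hf.full_left hc hκ (ih' k (by omega)) h
        · exact hf.full_right hc hκ (ih' k (by omega)) h
    | cac u v a =>
      cases u with
      | cons b u => exact key b _ _ (.cac u v a) hf
      | nil =>
        obtain ⟨k, rfl⟩ := three hf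
        exact (Fills.cac_iff hκ (ih' k (by omega))).1 hf
    | acc u v a =>
      cases u with
      | cons b u => exact key b _ _ (.acc u v a) hf
      | nil =>
        obtain ⟨k, rfl⟩ := three hf
        exact (Fills.cac_iff hκ (ih' k (by omega))).2 hf
    | aca u v a =>
      cases u with
      | cons b u => exact key b _ _ (.aca u v a) hf
      | nil =>
        obtain ⟨k, rfl⟩ := three hf
        exact (Fills.aca_iff hκ (ih' k (by omega))).1 hf
    | aac u v a =>
      cases u with
      | cons b u => exact key b _ _ (.aac u v a) hf
      | nil =>
        obtain ⟨k, rfl⟩ := three hf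
        exact (Fills.aca_iff hκ (ih' k (by omega))).2 hf

/-- The word `w`, its letters being taken from the right to the left, fills the shape `c` exactly,
starting from `κ`. -/
def Good (c : ℕ → ℕ) (w : List ℕ) (κ : ℕ → ℕ) : Prop := ∃ n, Fills c n w.reverse κ

theorem good_nil {c κ : ℕ → ℕ} : Good c [] κ ↔ κ = c := by simp [Good, Fills]

theorem good_append_singleton {c κ : ℕ → ℕ} {w : List ℕ} {a : ℕ} :
    Good c (w ++ [a]) κ ↔
      if Addable c κ a then Good c w (addCell κ a) else Good c ((a + 1) :: w) κ := by
  have hrev : (w ++ [a]).reverse = a :: w.reverse := by simp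
  simp only [Good, hrev, List.reverse_cons]
  constructor
  · rintro ⟨n, hn⟩
    cases n with
    | zero => simp [Fills] at hn
    | succ n =>
      simp only [Fills] at hn
      split <;> rename_i h <;> simp only [h, if_true, if_false] at hn <;> exact ⟨n, hn⟩
  · intro h
    split at h <;> rename_i h' <;> obtain ⟨n, hn⟩ := h <;> exact ⟨n + 1, by simpa [Fills, h'] using hn⟩

theorem good_of_not_addable {c κ : ℕ → ℕ} {w : List ℕ} {a : ℕ} (h : ¬ Addable c κ a) :
    Good c (w ++ [a]) κ ↔ Good c ((a + 1) :: w) κ := by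
  rw [good_append_singleton, if_neg h]

theorem good_rotate {c κ : ℕ → ℕ} {w e : List ℕ} (h : ∀ a ∈ e, ¬ Addable c κ a) :
    Good c (w ++ e) κ ↔ Good c (e.map (· + 1) ++ w) κ := by
  induction e using List.reverseRecOn generalizing w with
  | nil => simp
  | append_singleton e a ih =>
    simp only [List.mem_append, List.mem_singleton] at h
    rw [← List.append_assoc, good_of_not_addable (h a (Or.inr rfl)), ← List.cons_append,
      ih fun b hb => h b (Or.inl hb)]
    simp

theorem Good.of_local {c κ : ℕ → ℕ} (hc : Antitone c) (hκ : Antitone κ) {w w' : List ℕ}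
    (hl : Local c κ w.reverse w'.reverse) (h : Good c w κ) : Good c w' κ :=
  h.imp fun _ hn => hn.of_local hc hκ hl

/-- `a` and `b` may be interchanged when they are adjacent. -/
def Commutes (c κ : ℕ → ℕ) (a b : ℕ) : Prop :=
  (a + 2 ≤ b ∨ b + 2 ≤ a) ∨ (b = a + 1 ∧ c a ≤ κ a ∨ a = b + 1 ∧ c b ≤ κ b)

theorem Commutes.symm {c κ : ℕ → ℕ} {a b : ℕ} (h : Commutes c κ a b) : Commutes c κ b a := by
  unfold Commutes at *; tauto

theorem Good.swap {c κ : ℕ → ℕ} (hc : Antitone c) (hκ : Antitone κ) {u v : List ℕ} {a b : ℕ}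
    (hab : Commutes c κ a b) (h : Good c (u ++ a :: b :: v) κ) : Good c (u ++ b :: a :: v) κ := by
  refine h.of_local hc hκ ?_
  rcases hab with hab | hab
  · simpa using Local.comm v.reverse u.reverse hab.symm
  · simpa using Local.full v.reverse u.reverse hab.symm

theorem good_swap_blocks {c κ : ℕ → ℕ} (hc : Antitone c) (hκ : Antitone κ) {u v A B : List ℕ}
    (h : ∀ a ∈ A, ∀ b ∈ B, Commutes c κ a b) :
    Good c (u ++ (A ++ (B ++ v))) κ ↔ Good c (u ++ (B ++ (A ++ v))) κ := by
  have key : ∀ (a : ℕ) (u v B : List ℕ), (∀ b ∈ B, Commutes c κ a b) →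
      (Good c (u ++ a :: (B ++ v)) κ ↔ Good c (u ++ (B ++ a :: v)) κ) := by
    intro a u v B hB
    induction B generalizing u with
    | nil => simp
    | cons b B ih =>
      simp only [List.mem_cons, forall_eq_or_imp] at hB
      have e := ih (u ++ [b]) hB.2
      simp only [List.append_assoc, List.cons_append, List.nil_append] at e ⊢
      rw [← e]
      exact ⟨Good.swap hc hκ hB.1, Good.swap hc hκ hB.1.symm⟩
  induction A generalizing u with
  | nil => simp
  | cons a A ih =>
    simp only [List.mem_cons, forall_eq_or_imp] at h
    have e := ih (u := u ++ [a]) h.2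
    simp only [List.append_assoc, List.cons_append, List.nil_append] at e ⊢
    refine e.trans ?_
    simpa using key a u (A ++ v) B h.1

/-- If the two exchanged letters differ by at least two, they commute outright. Otherwise all three
letters are `a` or `a + 1`, and the relation, read backwards, is one of the local moves on queues.
-/
theorem Good.of_kstep {c κ : ℕ → ℕ} (hc : Antitone c) (hκ : Antitone κ) {w w' : List ℕ}
    (h : KStep w w') : Good c w κ ↔ Good c w' κ := by
  cases h with
  | @bac u v a b d h₁ h₂ =>
    by_cases h : a + 2 ≤ d
    · simpa using good_swap_blocks hc hκ (u := u ++ [b]) (v := v) (A := [a]) (B := [d])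
        (by simpa [Commutes] using Or.inl (Or.inl h))
    · obtain rfl : d = a + 1 := by omega
      obtain rfl : b = a + 1 := by omega
      exact ⟨Good.of_local hc hκ (by simpa using Local.cac v.reverse u.reverse a),
        Good.of_local hc hκ (by simpa using Local.acc v.reverse u.reverse a)⟩
  | @acb u v a b d h₁ h₂ =>
    by_cases h : a + 2 ≤ d
    · simpa using good_swap_blocks hc hκ (u := u) (v := b :: v) (A := [a]) (B := [d])
        (by simpa [Commutes] using Or.inl (Or.inl h))
    · obtain rfl : d = a + 1 := by omega
      obtain rfl : b = a := by omega
      exact ⟨Good.of_local hc hκ (by simpa using Local.aca v.reverse u.reverse b),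
        Good.of_local hc hκ (by simpa using Local.aac v.reverse u.reverse b)⟩

theorem Good.of_kEq {c κ : ℕ → ℕ} (hc : Antitone c) (hκ : Antitone κ) {w w' : List ℕ}
    (h : KEq w w') : Good c w κ ↔ Good c w' κ := by
  induction h with
  | rel _ _ h => exact Good.of_kstep hc hκ h
  | refl => exact Iff.rfl
  | symm _ _ _ ih => exact ih.symm
  | trans _ _ _ _ _ ih ih' => exact ih.trans ih'

/-- The first `i` rows of `c`. -/
def firstRows (c : ℕ → ℕ) (i : ℕ) : ℕ → ℕ := fun j => if j < i then c j else 0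

theorem firstRows_antitone {c : ℕ → ℕ} (hc : Antitone c) (i : ℕ) : Antitone (firstRows c i) := by
  refine antitone_nat_of_succ_le fun j => ?_
  have := hc (Nat.le_succ j)
  simp only [firstRows, Nat.succ_eq_add_one] at *
  split <;> split <;> omega

theorem firstRows_of_lt {c : ℕ → ℕ} {i j : ℕ} (h : j < i) : firstRows c i j = c j := if_pos h

theorem firstRows_of_le {c : ℕ → ℕ} {i j : ℕ} (h : i ≤ j) : firstRows c i j = 0 :=
  if_neg (by omega)

theorem not_addable_firstRows {c : ℕ → ℕ} {i a : ℕ} (h : i < a) :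
    ¬ Addable c (firstRows c i) a := by
  rintro ⟨-, h2⟩
  rw [firstRows_of_le (by omega), firstRows_of_le (by omega)] at h2
  omega

theorem not_addable_firstRows_of_lt {c : ℕ → ℕ} {i a : ℕ} (h : a < i) :
    ¬ Addable c (firstRows c i) a :=
  not_addable_of_le (firstRows_of_lt h).ge

theorem good_fill_row {c : ℕ → ℕ} (hc : Antitone c) {i n : ℕ} (hn : c i ≤ n) {w : List ℕ} :
    Good c (w ++ List.replicate n i) (firstRows c i) ↔
      Good c (List.replicate (n - c i) (i + 1) ++ w) (firstRows c (i + 1)) := by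
  -- `j` cells of row `i` are already present and `k` are missing; the surplus letters `i` are dealt
  -- with afterwards by rotation.
  have key : ∀ k j, j + k = c i →
      (Good c (w ++ List.replicate (n - j) i) (Function.update (firstRows c i) i j) ↔
        Good c (w ++ List.replicate (n - c i) i) (firstRows c (i + 1))) := by
    intro k
    induction k with
    | zero =>
      intro j hj
      have : Function.update (firstRows c i) i j = firstRows c (i + 1) := by
        ext m
        simp only [Function.update, firstRows]
        grind
      rw [this]; simp at hj; rw [hj]
    | succ k ih =>
      intro j hj
      have h1 : n - j = n - (j + 1) + 1 := by omega
      rw [h1, List.replicate_succ', ← List.append_assoc, good_append_singleton, if_pos,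
        ← ih (j + 1) (by omega)]
      · have : addCell (Function.update (firstRows c i) i j) i =
            Function.update (firstRows c i) i (j + 1) := by
          ext m; simp [addCell]
        rw [this]
      · refine ⟨by simp; omega, ?_⟩
        rcases Nat.eq_zero_or_pos i with h | h
        · exact Or.inl h
        · right
          have := hc (show i - 1 ≤ i by omega)
          rw [Function.update_self, Function.update_of_ne (by omega), firstRows_of_lt (by omega)]
          omega
  have h0 : Function.update (firstRows c i) i 0 = firstRows c i := by
    rw [← firstRows_of_le (c := c) (le_refl i), Function.update_eq_self]
  have := key (c i) 0 (by omega)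
  rw [h0, Nat.sub_zero] at this
  rw [this, good_rotate]
  · simp
  · intro a ha
    rw [List.eq_of_mem_replicate ha]
    exact not_addable_firstRows_of_lt (by omega)

theorem good_process_row {c : ℕ → ℕ} (hc : Antitone c) {i n : ℕ} (hn : c i ≤ n) {w e : List ℕ}
    (he : ∀ a ∈ e, i < a) :
    Good c (w ++ (List.replicate n i ++ e)) (firstRows c i) ↔
      Good c (List.replicate (n - c i) (i + 1) ++ (e.map (· + 1) ++ w)) (firstRows c (i + 1)) := by
  rw [← List.append_assoc, good_rotate fun a ha => not_addable_firstRows (he a ha),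
    ← List.append_assoc, good_fill_row hc hn]

theorem mem_rowWord {a : ℕ} {T : Filling} : a ∈ rowWord T ↔ ∃ r ∈ T, a ∈ r := by
  simp [rowWord]

theorem IsTab.lt_of_above {U : Filling} (hU : IsTab U) {r : List ℕ} (h : Above r (firstRow U))
    {i : ℕ} (hr : ∀ a ∈ r, i ≤ a) : ∀ a ∈ rowWord U, i < a := by
  induction U generalizing r with
  | nil => simp
  | cons s U ih =>
    obtain ⟨-, h1, h2, h3⟩ := hU
    have hs : ∀ a ∈ s, i < a := fun a ha => by
      obtain ⟨b, hb, hba⟩ := h.exists_lt ha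
      exact (hr b hb).trans_lt hba
    intro a ha
    rw [rowWord_cons, List.mem_append] at ha
    rcases ha with ha | ha
    · exact ih h3 h2 (fun b hb => (hs b hb).le) a ha
    · exact hs a ha

theorem eq_replicate_append {i : ℕ} {r : List ℕ} (hr : r.Pairwise (· ≤ ·)) (hi : ∀ a ∈ r, i ≤ a) :
    ∃ n e, r = List.replicate n i ++ e ∧ ∀ a ∈ e, i < a := by
  induction r with
  | nil => exact ⟨0, [], rfl, by simp⟩
  | cons b r ih =>
    rw [List.pairwise_cons] at hr
    simp only [List.mem_cons, forall_eq_or_imp] at hi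
    rcases hi.1.eq_or_lt with rfl | h
    · obtain ⟨n, e, rfl, he⟩ := ih hr.2 hi.2
      exact ⟨n + 1, e, rfl, he⟩
    · refine ⟨0, b :: r, rfl, ?_⟩
      simp only [List.mem_cons, forall_eq_or_imp]
      exact ⟨h, fun a ha => h.trans_le (hr.1 a ha)⟩

/-- In the word of a tableau split along a vertical line, the right part may be rotated to the
front, if the left part is wide enough. -/
theorem good_rotate_right_part {c : ℕ → ℕ} (hc : Antitone c) {l : ℕ} {U : Filling}
    (hU : IsTab U) {i : ℕ} (hl : c i ≤ l) (hi : ∀ a ∈ rowWord U, i ≤ a) (g q : ℕ) (Z : List ℕ) :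
    Good c (List.replicate (g + q) i ++
        (Z ++ (rowWord (U.map (List.take l)) ++ rowWord (U.map (List.drop l))))) (firstRows c i) ↔
      Good c (List.replicate g i ++ ((rowWord (U.map (List.drop l))).map (· + 1) ++
        (List.replicate q i ++ (Z ++ rowWord (U.map (List.take l)))))) (firstRows c i) := by
  -- The blocks of `g` and `q` letters and the word `Z` are there for the induction: they hold the
  -- letters left over from rows already processed.
  induction U generalizing i g q Z with
  | nil => simp [← List.append_assoc]
  | cons r U ih =>
    -- Without letters `i`, nothing in the right part can be added. After rotation its letters are
    -- at least `i + 2`, so they pass the block of letters `i` freely.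
    by_cases h : ∀ a ∈ rowWord ((r :: U).map (List.drop l)), i < a
    · rw [← List.append_assoc, ← List.append_assoc,
        good_rotate fun a ha => not_addable_firstRows (h a ha), List.replicate_add]
      simp only [List.append_assoc]
      have := good_swap_blocks hc (firstRows_antitone hc i) (u := [])
        (v := List.replicate q i ++ (Z ++ rowWord ((r :: U).map (List.take l))))
        (A := (rowWord ((r :: U).map (List.drop l))).map (· + 1)) (B := List.replicate g i) ?_
      · simpa only [List.nil_append] using this
      · intro a ha b hb
        rw [List.eq_of_mem_replicate hb]
        obtain ⟨a', ha', rfl⟩ := List.mem_map.1 ha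
        have := h a' ha'
        exact Or.inl (Or.inr (by omega))
    · obtain ⟨-, h1, h2, h3⟩ := id hU
      simp only [rowWord_cons, List.mem_append] at hi
      have hr : ∀ a ∈ r, i ≤ a := fun a ha => hi a (Or.inr ha)
      have hUi := h3.lt_of_above h2 hr
      obtain ⟨n, e, rfl, he⟩ := eq_replicate_append h1 hr
      -- A letter `i` in the right part must come from the top row, which then starts with more than
      -- `l` of them. The left part of that row thus consists of letters `i` only.
      have hn : l < n := by
        by_contra hn
        refine h fun a ha => ?_
        simp only [List.map_cons, rowWord_cons, List.mem_append] at ha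
        rcases ha with ha | ha
        · refine hUi a ?_
          rw [mem_rowWord] at ha ⊢
          obtain ⟨s, hs, has⟩ := ha
          obtain ⟨s', hs', rfl⟩ := List.mem_map.1 hs
          exact ⟨s', hs', List.mem_of_mem_drop has⟩
        · rw [List.drop_append, List.drop_replicate, Nat.sub_eq_zero_of_le (by omega)] at ha
          exact he a (List.mem_of_mem_drop (by simpa using ha))
      have htake : (List.replicate n i ++ e).take l = List.replicate l i := by
        rw [List.take_append_of_le_length (by simpa using hn.le), List.take_replicate,
          min_eq_left hn.le]
      have hdrop : (List.replicate n i ++ e).drop l = List.replicate (n - l) i ++ e := by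
        rw [List.drop_append_of_le_length (by simpa using hn.le), List.drop_replicate]
      have hκ := firstRows_antitone hc
      have hl' : c (i + 1) ≤ l := (hc (Nat.le_succ i)).trans hl
      -- Once row `i` is filled, the surplus returns as letters `i + 1`: `l - c i` of them are
      -- charged to the left part of the top row and `n - l` to its right part. These are the new
      -- `g` and `q`.
      have IH := ih h3 hl' hUi (l - c i) (n - l) (e.map (· + 1) ++ (List.replicate (g + q) i ++ Z))
      have e1 := Good.of_kEq hc (hκ i) ((rowWord_split l hU).append_left
        (List.replicate (g + q) i ++ Z))
      have e2 := Good.of_kEq hc (hκ (i + 1)) ((rowWord_split l h3).append_left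
        (List.replicate (n - c i) (i + 1) ++ (e.map (· + 1) ++ (List.replicate (g + q) i ++ Z))))
      have e3 := good_process_row hc (show c i ≤ n by omega)
        (w := List.replicate (g + q) i ++ (Z ++ rowWord U)) he
      have e4 := good_process_row hc hl (e := [])
        (w := List.replicate g i ++ ((rowWord (U.map (List.drop l))).map (· + 1) ++
          (List.replicate (n - l) (i + 1) ++ (e.map (· + 1) ++ (List.replicate q i ++
            (Z ++ rowWord (U.map (List.take l)))))))) (by simp)
      -- The `g` letters `i` have to cross the rotated right part. They commute with `i + 1` because
      -- row `i` is now full, and the other letters are at least `i + 2`.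
      have e5 := good_swap_blocks hc (hκ (i + 1)) (u := List.replicate (l - c i) (i + 1))
        (A := List.replicate g i)
        (B := (rowWord (U.map (List.drop l))).map (· + 1) ++
          (List.replicate (n - l) (i + 1) ++ e.map (· + 1)))
        (v := List.replicate q i ++ (Z ++ rowWord (U.map (List.take l)))) ?_
      · have hlen : l - c i + (n - l) = n - c i := by omega
        simp only [List.map_cons, rowWord_cons, htake, hdrop, List.append_assoc, List.map_append,
          List.map_replicate, List.append_nil, List.map_nil, List.nil_append, hlen,
          List.replicate_add g q] at e1 e2 e3 e4 e5 IH ⊢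
        rw [← e1, e3, e2, IH, e4, e5]
      · intro a ha b hb
        rw [List.eq_of_mem_replicate ha]
        have hfull : c i ≤ firstRows c (i + 1) i := (firstRows_of_lt (Nat.lt_succ_self i)).ge
        simp only [List.mem_append, List.mem_map] at hb
        rcases hb with ⟨b, hb, rfl⟩ | hb | ⟨b, hb, rfl⟩
        · have : i < b := by
            refine hUi b ?_
            rw [mem_rowWord] at hb ⊢
            obtain ⟨s, hs, has⟩ := hb
            obtain ⟨s', hs', rfl⟩ := List.mem_map.1 hs
            exact ⟨s', hs', List.mem_of_mem_drop has⟩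
          exact Or.inl (Or.inl (by omega))
        · rw [List.eq_of_mem_replicate hb]
          exact Or.inr (Or.inl ⟨rfl, hfull⟩)
        · have := he b hb
          exact Or.inl (Or.inl (by omega))

/-! ### Cocharge labels -/

/-- `a` stands before `b` in `w`. -/
def Before (w : List ℕ) (a b : ℕ) : Prop := [a, b].Sublist w

theorem before_cons {x a b : ℕ} {w : List ℕ} :
    Before (x :: w) a b ↔ a = x ∧ b ∈ w ∨ Before w a b := by
  unfold Before
  rw [List.sublist_cons_iff]
  constructor
  · rintro (h | ⟨r, h, h'⟩)
    · exact Or.inr h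
    · rw [List.cons.injEq] at h
      obtain ⟨rfl, rfl⟩ := h
      exact Or.inl ⟨rfl, List.singleton_sublist.1 h'⟩
  · rintro (⟨rfl, h⟩ | h)
    · exact Or.inr ⟨[b], rfl, List.singleton_sublist.2 h⟩
    · exact Or.inl h

@[simp] theorem not_before_nil {a b : ℕ} : ¬ Before [] a b := by simp [Before]

theorem Before.mem_left {w : List ℕ} {a b : ℕ} (h : Before w a b) : a ∈ w :=
  h.subset (by simp)

theorem Before.mem_right {w : List ℕ} {a b : ℕ} (h : Before w a b) : b ∈ w :=
  h.subset (by simp)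

theorem before_append {u v : List ℕ} {a b : ℕ} :
    Before (u ++ v) a b ↔ Before u a b ∨ Before v a b ∨ a ∈ u ∧ b ∈ v := by
  induction u with
  | nil => simp
  | cons x u ih =>
    rw [List.cons_append, before_cons, before_cons, ih, List.mem_append, List.mem_cons]
    tauto

theorem Before.total {w : List ℕ} {a b : ℕ} (ha : a ∈ w) (hb : b ∈ w) (hab : a ≠ b) :
    Before w a b ∨ Before w b a := by
  induction w with
  | nil => simp at ha
  | cons x w ih =>
    rw [before_cons, before_cons]
    rcases List.mem_cons.1 ha with rfl | ha' <;> rcases List.mem_cons.1 hb with rfl | hb'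
    · exact absurd rfl hab
    · exact Or.inl (Or.inl ⟨rfl, hb'⟩)
    · exact Or.inr (Or.inl ⟨rfl, ha'⟩)
    · rcases ih ha' hb' with h | h <;> tauto

theorem Before.asymm {w : List ℕ} (hw : w.Nodup) {a b : ℕ} (h : Before w a b) :
    ¬ Before w b a := by
  induction w with
  | nil => simp
  | cons x w ih =>
    rw [List.nodup_cons] at hw
    rw [before_cons] at h ⊢
    rintro (⟨rfl, h'⟩ | h')
    · rcases h with ⟨rfl, h⟩ | h
      · exact hw.1 h
      · exact hw.1 h.mem_right
    · rcases h with ⟨rfl, h⟩ | h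
      · exact hw.1 h'.mem_right
      · exact ih hw.2 h h'

theorem Before.trans {w : List ℕ} (hw : w.Nodup) {a b d : ℕ} (h : Before w a b)
    (h' : Before w b d) : Before w a d := by
  induction w with
  | nil => simp at h
  | cons x w ih =>
    rw [List.nodup_cons] at hw
    rw [before_cons] at h h' ⊢
    rcases h with ⟨rfl, h⟩ | h <;> rcases h' with ⟨rfl, h'⟩ | h'
    · exact Or.inl ⟨rfl, h'⟩
    · exact Or.inl ⟨rfl, h'.mem_right⟩
    · exact absurd h.mem_right hw.1
    · exact Or.inr (ih hw.2 h h')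

theorem Before.swap {u v : List ℕ} {x y a b : ℕ} (h : Before (u ++ x :: y :: v) a b) :
    Before (u ++ y :: x :: v) a b ∨ a = x ∧ b = y := by
  simp only [before_append, before_cons, List.mem_cons] at h ⊢
  tauto

theorem exists_pred {w : List ℕ} {a b : ℕ} (ha : a ∈ w) (hab : a < b) :
    ∃ p ∈ w, a ≤ p ∧ p < b ∧ ∀ d ∈ w, d ≤ p ∨ b ≤ d := by
  have hne : (w.toFinset.filter (· < b)).Nonempty := ⟨a, by simp [ha, hab]⟩
  have hmem := Finset.max'_mem _ hne
  have hle := fun d hd => Finset.le_max' (w.toFinset.filter (· < b)) d hd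
  simp only [Finset.mem_filter, List.mem_toFinset] at hmem
  refine ⟨_, hmem.1, hle a (by simp [ha, hab]), hmem.2, fun d hd => ?_⟩
  rcases Nat.lt_or_ge d b with h | h
  · exact Or.inl (hle d (by simp [hd, h]))
  · exact Or.inr h

/-- `L` gives the cocharge labels of the letters of `w`: the smallest letter has label zero, and
the next letter after `a` has the same label as `a` if it stands behind `a`, else one more. -/
structure IsLab (w : List ℕ) (L : ℕ → ℕ) : Prop where
  zero : ∀ v ∈ w, (∀ u ∈ w, v ≤ u) → L v = 0
  same : ∀ a ∈ w, ∀ b ∈ w, a < b → (∀ d ∈ w, d ≤ a ∨ b ≤ d) → Before w a b → L b = L a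
  succ : ∀ a ∈ w, ∀ b ∈ w, a < b → (∀ d ∈ w, d ≤ a ∨ b ≤ d) → Before w b a → L b = L a + 1

/-- Descend from `b` to `a` through predecessors in value. Labels never increase on the way, and if
they were constant, each predecessor would stand before its successor, hence `a` before `b`. -/
theorem IsLab.mono_aux {w : List ℕ} {L : ℕ → ℕ} (h : IsLab w L) (hw : w.Nodup) {a b : ℕ}
    (ha : a ∈ w) (hb : b ∈ w) (hab : a < b) : L a ≤ L b ∧ (Before w b a → L a < L b) := by
  induction b using Nat.strong_induction_on with
  | _ b ih =>
    obtain ⟨p, hp, hap, hpb, hcons⟩ := exists_pred ha hab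
    have hstep : L b = L p ∧ Before w p b ∨ L b = L p + 1 ∧ Before w b p := by
      rcases Before.total hp hb hpb.ne with h' | h'
      · exact Or.inl ⟨h.same p hp b hb hpb hcons h', h'⟩
      · exact Or.inr ⟨h.succ p hp b hb hpb hcons h', h'⟩
    rcases hap.eq_or_lt with rfl | hap
    · rcases hstep with ⟨h1, h2⟩ | ⟨h1, h2⟩
      · exact ⟨h1.ge, fun h' => absurd h' (h2.asymm hw)⟩
      · exact ⟨by omega, fun _ => by omega⟩
    · obtain ⟨h3, h4⟩ := ih p hpb hp hap
      rcases hstep with ⟨h1, h2⟩ | ⟨h1, h2⟩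
      · exact ⟨by omega, fun h' => h1 ▸ h4 (h2.trans hw h')⟩
      · exact ⟨by omega, fun _ => by omega⟩

theorem IsLab.mono {w : List ℕ} {L : ℕ → ℕ} (h : IsLab w L) (hw : w.Nodup) {a b : ℕ}
    (ha : a ∈ w) (hb : b ∈ w) (hab : a ≤ b) : L a ≤ L b := by
  rcases hab.eq_or_lt with rfl | hab
  · exact le_rfl
  · exact (h.mono_aux hw ha hb hab).1

theorem IsLab.strictMono {w : List ℕ} {L : ℕ → ℕ} (h : IsLab w L) (hw : w.Nodup) {a b : ℕ}
    (hab : a < b) (hba : Before w b a) : L a < L b :=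
  (h.mono_aux hw hba.mem_right hba.mem_left hab).2 hba

/-- Labels depend only on the relative positions of letters consecutive in value, and `m` lies
strictly between `x` and `y`. In a Knuth step on distinct letters, the third letter plays the role
of `m`. -/
theorem IsLab.swap {u v : List ℕ} {x y m : ℕ} {L : ℕ → ℕ} (h : IsLab (u ++ x :: y :: v) L)
    (hm : m ∈ u ++ x :: y :: v) (hxy : x < m ∧ m < y ∨ y < m ∧ m < x) :
    IsLab (u ++ y :: x :: v) L := by
  have hmem : ∀ d, d ∈ u ++ y :: x :: v ↔ d ∈ u ++ x :: y :: v := by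
    intro d; simp only [List.mem_append, List.mem_cons]; tauto
  constructor
  · intro d hd hmin
    exact h.zero d ((hmem d).1 hd) fun e he => hmin e ((hmem e).2 he)
  · intro a ha b hb hab hc hB
    refine h.same a ((hmem a).1 ha) b ((hmem b).1 hb) hab (fun d hd => hc d ((hmem d).2 hd)) ?_
    rcases hB.swap with h' | ⟨rfl, rfl⟩
    · exact h'
    · have := hc m ((hmem m).2 hm); omega
  · intro a ha b hb hab hc hB
    refine h.succ a ((hmem a).1 ha) b ((hmem b).1 hb) hab (fun d hd => hc d ((hmem d).2 hd)) ?_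
    rcases hB.swap with h' | ⟨rfl, rfl⟩
    · exact h'
    · have := hc m ((hmem m).2 hm); omega

theorem isLab_iff_of_kStep {w w' : List ℕ} {L : ℕ → ℕ} (hw : w.Nodup) (h : KStep w w') :
    IsLab w L ↔ IsLab w' L := by
  cases h with
  | @bac u v a b d h₁ h₂ =>
    have hbd : b ≠ d := by rintro rfl; simp [List.nodup_append] at hw
    have e : ∀ x y : ℕ, u ++ [b, x, y] ++ v = (u ++ [b]) ++ x :: y :: v := by simp
    rw [e, e]
    exact ⟨fun h => h.swap (m := b) (by simp) (by omega),
      fun h => h.swap (m := b) (by simp) (by omega)⟩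
  | @acb u v a b d h₁ h₂ =>
    have hbd : a ≠ b := by rintro rfl; simp [List.nodup_append] at hw
    have e : ∀ x y : ℕ, u ++ [x, y, b] ++ v = u ++ x :: y :: (b :: v) := by simp
    rw [e, e]
    exact ⟨fun h => h.swap (m := b) (by simp) (by omega),
      fun h => h.swap (m := b) (by simp) (by omega)⟩

theorem isLab_iff_of_kEq {w w' : List ℕ} {L : ℕ → ℕ} (h : KEq w w') (hw : w.Nodup) :
    IsLab w L ↔ IsLab w' L := by
  induction h with
  | rel _ _ h => exact isLab_iff_of_kStep hw h
  | refl => exact Iff.rfl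
  | symm x y h ih => exact (ih ((KEq.perm h).nodup_iff.2 hw)).symm
  | trans x y z h _ ih ih' => exact (ih hw).trans (ih' ((KEq.perm h).nodup_iff.1 hw))

/-- The larger letter of the strict inequality stands before the smaller one, so strictness survives
in the labels; the other inequality only has to survive weakly. -/
theorem KStep.map_lab {w w' : List ℕ} {L : ℕ → ℕ} (hw : w.Nodup) (hL : IsLab w L)
    (h : KStep w w') : KStep (w.map L) (w'.map L) := by
  cases h with
  | @bac u v a b d h₁ h₂ =>
    have e1 : L a < L b := hL.strictMono hw h₁ (by simp [before_append, before_cons])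
    have e2 : L b ≤ L d := hL.mono hw (by simp) (by simp) h₂
    simpa using KStep.bac (u.map L) (v.map L) e1 e2
  | @acb u v a b d h₁ h₂ =>
    have e1 : L b < L d := hL.strictMono hw h₂ (by simp [before_append, before_cons])
    have e2 : L a ≤ L b := hL.mono hw (by simp) (by simp) h₁
    simpa using KStep.acb (u.map L) (v.map L) e2 e1

theorem KEq.map_lab {w w' : List ℕ} {L : ℕ → ℕ} (h : KEq w w') (hw : w.Nodup) (hL : IsLab w L) :
    KEq (w.map L) (w'.map L) := by
  induction h with
  | rel _ _ h => exact .rel _ _ (h.map_lab hw hL)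
  | refl => exact .refl _
  | symm x y h ih =>
    have hx := (KEq.perm h).nodup_iff.2 hw
    exact (ih hx ((isLab_iff_of_kEq h hx).2 hL)).symm
  | trans x y z h _ ih ih' =>
    exact (ih hw hL).trans (ih' ((KEq.perm h).nodup_iff.1 hw) ((isLab_iff_of_kEq h hw).1 hL))

/-- The label of `v` counts the letters `b ≤ v` that stand before their predecessor in value. -/
theorem exists_isLab {w : List ℕ} (hw : w.Nodup) : ∃ L, IsLab w L := by
  classical
  let D : ℕ → Prop := fun b => ∃ a ∈ w, a < b ∧ (∀ d ∈ w, d ≤ a ∨ b ≤ d) ∧ Before w b a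
  refine ⟨fun v => (w.toFinset.filter fun b => b ≤ v ∧ D b).card, ?_, ?_, ?_⟩
  · intro v _ hmin
    rw [Finset.card_eq_zero, Finset.filter_eq_empty_iff]
    rintro b - ⟨hb, a, ha, hab, -⟩
    have := hmin a ha
    omega
  · intro a ha b hb hab hc hB
    congr 1
    refine Finset.filter_congr fun d hd => ?_
    rw [List.mem_toFinset] at hd
    constructor
    · rintro ⟨h1, h2⟩
      refine ⟨?_, h2⟩
      by_contra h3
      obtain rfl : d = b := by have := hc d hd; omega
      obtain ⟨a', ha', hab', hc', hB'⟩ := h2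
      obtain rfl : a' = a := by have := hc a' ha'; have := hc' a ha; omega
      exact hB.asymm hw hB'
    · rintro ⟨h1, h2⟩
      exact ⟨by omega, h2⟩
  · intro a ha b hb hab hc hB
    have : w.toFinset.filter (fun d => d ≤ b ∧ D d) =
        insert b (w.toFinset.filter fun d => d ≤ a ∧ D d) := by
      ext d
      simp only [Finset.mem_filter, List.mem_toFinset, Finset.mem_insert]
      constructor
      · rintro ⟨hd, h1, h2⟩
        have := hc d hd
        by_cases h : d = b
        · exact Or.inl h
        · exact Or.inr ⟨hd, by omega, h2⟩
      · rintro (rfl | ⟨hd, h1, h2⟩)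
        · exact ⟨hb, le_rfl, a, ha, hab, hc, hB⟩
        · exact ⟨hd, by omega, h2⟩
    rw [this, Finset.card_insert_of_notMem]
    simp only [Finset.mem_filter, not_and]
    intro _ h
    omega

/-- The labels after the letters of `C` have been moved to the front and the letters with label
zero in front of `C` have been removed. -/
def rotLab (L : ℕ → ℕ) (C : List ℕ) (v : ℕ) : ℕ := L v + (if v ∈ C then 1 else 0) - 1

/-- Only pairs of consecutive values with one member in `A` and one in `C` change their order. The
labels of `A` drop by one and those of `C` stay, which is the correction needed for exactly these
pairs. -/
theorem IsLab.rotate {A B C : List ℕ} {L : ℕ → ℕ} (hw : (A ++ (B ++ C)).Nodup)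
    (h : IsLab (A ++ (B ++ C)) L) (hB0 : B ≠ []) (hB : ∀ b ∈ B, L b = 0)
    (hlt : ∀ b ∈ B, ∀ v ∈ A ++ C, b < v) (hA : ∀ v ∈ A, 1 ≤ L v) :
    IsLab (C ++ A) (rotLab L C) := by
  have hAC : ∀ v ∈ A, v ∉ C := by
    intro v hv hv'
    rw [List.nodup_append] at hw
    exact hw.2.2 v hv v (by simp [hv']) rfl
  have hLA : ∀ v ∈ A, rotLab L C v = L v - 1 := fun v hv => by simp [rotLab, hAC v hv]
  have hLC : ∀ v ∈ C, rotLab L C v = L v := fun v hv => by simp [rotLab, hv]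
  have hcons : ∀ a ∈ C ++ A, ∀ b, (∀ d ∈ C ++ A, d ≤ a ∨ b ≤ d) →
      ∀ d ∈ A ++ (B ++ C), d ≤ a ∨ b ≤ d := by
    intro a ha b hd d hd'
    simp only [List.mem_append] at ha hd hd' hlt
    rcases hd' with h' | h' | h'
    · exact hd d (Or.inr h')
    · exact Or.inl (hlt d h' a (by tauto)).le
    · exact hd d (Or.inl h')
  constructor
  · intro v hv hmin
    obtain ⟨x, hx⟩ := List.exists_mem_of_ne_nil B hB0
    -- The smallest remaining letter `v` succeeds the largest letter of `B`, whose label is zero; so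
    -- `v` had label zero in `C` or one in `A`.
    obtain ⟨b, hb, -, hbv, hbc⟩ := exists_pred (w := B) (b := v) hx (hlt x hx v (by
      simp only [List.mem_append] at hv ⊢; tauto))
    have hc : ∀ d ∈ A ++ (B ++ C), d ≤ b ∨ v ≤ d := by
      intro d hd
      simp only [List.mem_append] at hd hmin
      rcases hd with h' | h' | h'
      · exact Or.inr (hmin d (Or.inr h'))
      · exact hbc d h'
      · exact Or.inr (hmin d (Or.inl h'))
    rcases List.mem_append.1 hv with hv | hv
    · rw [hLC v hv, h.same b (by simp [hb]) v (by simp [hv]) hbv hc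
        (by simp [before_append, hb, hv]), hB b hb]
    · rw [hLA v hv, h.succ b (by simp [hb]) v (by simp [hv]) hbv hc
        (by simp [before_append, hb, hv]), hB b hb]
  · intro a ha b hb hab hd hBf
    have hd' := hcons a ha b hd
    rw [before_append] at hBf
    rcases hBf with h' | h' | ⟨h1, h2⟩
    · rw [hLC a h'.mem_left, hLC b h'.mem_right]
      exact h.same a (by simp [h'.mem_left]) b (by simp [h'.mem_right]) hab hd'
        (by simp [before_append, h'])
    · rw [hLA a h'.mem_left, hLA b h'.mem_right]
      rw [h.same a (by simp [h'.mem_left]) b (by simp [h'.mem_right]) hab hd'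
        (by simp [before_append, h'])]
    · rw [hLC a h1, hLA b h2]
      rw [h.succ a (by simp [h1]) b (by simp [h2]) hab hd' (by simp [before_append, h1, h2])]
      rfl
  · intro a ha b hb hab hd hBf
    have hd' := hcons a ha b hd
    rw [before_append] at hBf
    rcases hBf with h' | h' | ⟨h1, h2⟩
    · rw [hLC a h'.mem_right, hLC b h'.mem_left]
      exact h.succ a (by simp [h'.mem_right]) b (by simp [h'.mem_left]) hab hd'
        (by simp [before_append, h'])
    · rw [hLA a h'.mem_right, hLA b h'.mem_left]
      rw [h.succ a (by simp [h'.mem_right]) b (by simp [h'.mem_left]) hab hd'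
        (by simp [before_append, h'])]
      have := hA a h'.mem_right
      omega
    · rw [hLC b h1, hLA a h2]
      rw [h.same a (by simp [h2]) b (by simp [h1]) hab hd' (by simp [before_append, h1, h2])]
      have := hA a h2
      omega

/-! ### Catabolism in terms of labels -/

/-- With row zero full and `c 1 ≤ c 0`, row zero never obstructs row one, so the remaining rows are
filled as if they began at zero. -/
theorem good_shift {c c' : ℕ → ℕ} (hc : c 1 ≤ c 0) (hc' : ∀ i, c' i = c (i + 1)) {w : List ℕ} :
    Good c (w.map (· + 1)) (firstRows c 1) ↔ Good c' w (firstRows c' 0) := by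
  have key : ∀ n (x : List ℕ) (κ κ' : ℕ → ℕ), κ 0 = c 0 → (∀ i, κ' i = κ (i + 1)) →
      (Fills c n (x.map (· + 1)) κ ↔ Fills c' n x κ') := by
    intro n
    induction n with
    | zero =>
      intro x κ κ' h0 h
      cases x with
      | nil =>
        simp only [Fills, List.map_nil, funext_iff, h, hc']
        exact ⟨fun h i => h _, fun h i => by cases i with
          | zero => exact h0
          | succ i => exact h i⟩
      | cons a x => simp [Fills]
    | succ n ih =>
      intro x κ κ' h0 h
      cases x with
      | nil =>
        simp only [Fills, List.map_nil, funext_iff, h, hc']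
        exact ⟨fun h i => h _, fun h i => by cases i with
          | zero => exact h0
          | succ i => exact h i⟩
      | cons a x =>
        have hadd : Addable c κ (a + 1) ↔ Addable c' κ' a := by
          simp only [Addable, h, hc']
          cases a with
          | zero => simp; omega
          | succ a => simp
        simp only [Fills, List.map_cons]
        have e1 := ih x (addCell κ (a + 1)) (addCell κ' a) (by simpa [addCell] using h0) (by
          intro i
          simp only [addCell, Function.update, h]
          grind)
        have e2 := ih (x ++ [a + 1]) κ κ' h0 h
        simp only [List.map_append, List.map_cons, List.map_nil] at e2
        simp only [hadd, e1, e2]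
  have h1 : (w.map (· + 1)).reverse = w.reverse.map (· + 1) := by simp
  simp only [Good, h1]
  refine exists_congr fun n => key n _ _ _ (firstRows_of_lt (by omega)) fun i => ?_
  simp [firstRows]

/-- Rotation only raises letters, so row zero can be filled only by zeros present from the
beginning. -/
theorem Good.le_count {c κ : ℕ → ℕ} {w : List ℕ} (h : Good c w κ) : c 0 ≤ κ 0 + w.count 0 := by
  obtain ⟨n, hn⟩ := h
  rw [← List.count_reverse]
  generalize w.reverse = x at hn
  induction n generalizing x κ with
  | zero => cases x with
    | nil => simp only [Fills] at hn; simp [hn]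
    | cons a x => simp [Fills] at hn
  | succ n ih => cases x with
    | nil => simp only [Fills] at hn; simp [hn]
    | cons a x =>
      simp only [Fills] at hn
      split at hn
      · have := ih _ hn
        by_cases ha : a = 0
        · subst ha
          rw [addCell, Function.update_self] at this
          rw [List.count_cons_self]; omega
        · rw [addCell, Function.update_of_ne (Ne.symm ha)] at this
          rwa [List.count_cons_of_ne ha]
      · have := ih _ hn
        rw [List.count_append, List.count_eq_zero_of_not_mem (l := [a + 1]) (by simp)] at this
        have := List.count_le_count_cons (a := 0) (b := a) (l := x)
        omega

/-- Applying `L` to the entries of a tableau. -/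
def relabel (L : ℕ → ℕ) (T : Filling) : Filling := T.map (List.map L)

theorem rowWord_relabel (L : ℕ → ℕ) (T : Filling) :
    rowWord (relabel L T) = (rowWord T).map L := by
  simp [rowWord, relabel, List.map_flatten, List.map_reverse]

theorem Above.map {L : ℕ → ℕ} {r s : List ℕ} (h : Above r s)
    (hL : ∀ a ∈ r, ∀ b ∈ s, a < b → L a < L b) : Above (r.map L) (s.map L) := by
  induction r generalizing s with
  | nil => cases s <;> simp_all
  | cons a r ih => cases s with
    | nil => simp
    | cons b s =>
      simp only [List.map_cons, above_cons]
      exact ⟨hL a (by simp) b (by simp) h.1,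
        ih h.2 fun x hx y hy => hL x (by simp [hx]) y (by simp [hy])⟩

/-- An entry below another one stands earlier in the reading word, so columns stay strict, while
rows need only monotonicity. -/
theorem IsTab.relabel_of_mono {T : Filling} (hT : IsTab T) {L : ℕ → ℕ}
    (h1 : ∀ a ∈ rowWord T, ∀ b ∈ rowWord T, a ≤ b → L a ≤ L b)
    (h2 : ∀ a b, a < b → Before (rowWord T) b a → L a < L b) : IsTab (relabel L T) := by
  induction T with
  | nil => trivial
  | cons r t ih =>
    obtain ⟨h3, h4, h5, h6⟩ := hT
    simp only [rowWord_cons, List.mem_append] at h1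
    refine ⟨by simpa using h3, ?_, ?_, ?_⟩
    · rw [List.pairwise_map]
      exact h4.imp_of_mem fun ha hb hab => h1 _ (Or.inr ha) _ (Or.inr hb) hab
    · have : firstRow (List.map (List.map L) t) = (firstRow t).map L := by
        cases t <;> simp [firstRow]
      rw [this]
      refine h5.map fun a ha b hb hab => h2 a b hab ?_
      have : b ∈ rowWord t := by
        cases t with
        | nil => simp [firstRow] at hb
        | cons s t => simp only [rowWord_cons, List.mem_append]; exact Or.inr hb
      simp [before_append, this, ha]
    · exact ih h6 (fun a ha b hb => h1 a (Or.inl ha) b (Or.inl hb))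
        fun a b hab hb => h2 a b hab (by simp [before_append, hb])

theorem IsTab.relabel {T : Filling} (hT : IsTab T) {L : ℕ → ℕ} (hw : (rowWord T).Nodup)
    (hL : IsLab (rowWord T) L) : IsTab (relabel L T) :=
  hT.relabel_of_mono (fun _ ha _ hb hab => hL.mono hw ha hb hab)
    fun _ _ hab hba => hL.strictMono hw hab hba

/-- The first row of a labelled tableau starts with its zeros, and the other rows have none. -/
theorem IsTab.zeros {r : List ℕ} {t : Filling} (hT : IsTab (r :: t)) {L : ℕ → ℕ}
    (hw : (rowWord (r :: t)).Nodup) (hL : IsLab (rowWord (r :: t)) L) :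
    (∃ n e, r.map L = List.replicate n 0 ++ e ∧ (∀ a ∈ e, 0 < a) ∧
      ((rowWord (r :: t)).map L).count 0 = n) ∧ ∀ v ∈ rowWord t, 1 ≤ L v := by
  obtain ⟨-, h1, h2, h3⟩ := hT.relabel hw hL
  obtain ⟨n, e, hr, he⟩ := eq_replicate_append h1 (i := 0) (by simp)
  have ht := h3.lt_of_above h2 (i := 0) (by simp)
  have e1 : rowWord (List.map (List.map L) t) = (rowWord t).map L := rowWord_relabel L t
  rw [e1] at ht
  refine ⟨⟨n, e, hr, he, ?_⟩, fun v hv => ht _ (List.mem_map_of_mem hv)⟩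
  rw [rowWord_cons, List.map_append, List.count_append, hr, List.count_append,
    List.count_eq_zero_of_not_mem fun h => absurd (ht _ h) (by omega),
    List.count_eq_zero_of_not_mem fun h => absurd (he _ h) (by omega)]
  simp

/-! ### Smallest entries and zero labels -/

theorem hasSmallest_nil {m : ℕ} : HasSmallest m [] ↔ m = 0 := by
  simp [HasSmallest, firstRow]

theorem mem_flatten_iff {T : Filling} {a : ℕ} : a ∈ T.flatten ↔ a ∈ rowWord T := by
  simp [mem_rowWord]

theorem rowWord_perm (T : Filling) : (rowWord T).Perm T.flatten :=
  (List.reverse_perm T).flatten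

theorem sorted_lt {r : List ℕ} (h : r.Pairwise (· ≤ ·)) (hn : r.Nodup) : r.Pairwise (· < ·) :=
  h.imp₂ (fun _ _ h h' => lt_of_le_of_ne h h') hn

theorem before_of_sorted {r : List ℕ} (h : r.Pairwise (· ≤ ·)) {a b : ℕ} (ha : a ∈ r)
    (hb : b ∈ r) (hab : a < b) : Before r a b := by
  rcases Before.total ha hb hab.ne with h' | h'
  · exact h'
  · have := h.sublist h'
    simp at this
    omega

/-- The entries counted by `HasSmallest` have label zero. -/
theorem HasSmallest.lab_eq_zero {r : List ℕ} {t : Filling} {m : ℕ} (h : HasSmallest m (r :: t))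
    (hr : r.Pairwise (· ≤ ·)) {L : ℕ → ℕ} (hL : IsLab (rowWord (r :: t)) L) :
    ∀ v ∈ r.take m, L v = 0 := by
  have hmem : ∀ d, d ∈ rowWord (r :: t) ↔ d ∈ r.take m ∨ d ∈ r.drop m ++ t.flatten := by
    intro d
    rw [rowWord_cons, List.mem_append, List.mem_append, mem_flatten_iff]
    nth_rewrite 1 [← List.take_append_drop m r]
    rw [List.mem_append]; tauto
  have hlt := h.2
  simp only [firstRow, List.headD_cons, List.tail_cons] at hlt
  intro v
  induction v using Nat.strong_induction_on with
  | _ v ih =>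
    intro hv
    have hv' : v ∈ rowWord (r :: t) := (hmem v).2 (Or.inl hv)
    by_cases hmin : ∀ u ∈ rowWord (r :: t), v ≤ u
    · exact hL.zero v hv' hmin
    · push Not at hmin
      obtain ⟨u, hu, huv⟩ := hmin
      obtain ⟨p, hp, -, hpv, hc⟩ := exists_pred hu huv
      have hpt : p ∈ r.take m := by
        rcases (hmem p).1 hp with h' | h'
        · exact h'
        · have := hlt v hv p h'; omega
      rw [hL.same p hp v hv' hpv hc, ih p hpv hpt]
      rw [rowWord_cons, before_append]
      exact Or.inr (Or.inl (before_of_sorted hr (List.mem_of_mem_take hpt)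
        (List.mem_of_mem_take hv) hpv))

theorem hasSmallest_iff {T : Filling} (hT : IsTab T) {L : ℕ → ℕ} (hw : (rowWord T).Nodup)
    (hL : IsLab (rowWord T) L) {m : ℕ} :
    HasSmallest m T ↔ m ≤ ((rowWord T).map L).count 0 := by
  cases T with
  | nil => simp [hasSmallest_nil]
  | cons r t =>
    obtain ⟨⟨n, e, hr, he, hn⟩, ht⟩ := hT.zeros hw hL
    obtain ⟨-, h1, h2, h3⟩ := hT
    constructor
    · intro h
      have h0 := h.lab_eq_zero h1 hL
      have hlen := h.1
      simp only [firstRow, List.headD_cons] at hlen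
      calc m = (r.take m).length := by simp [hlen]
        _ = ((r.take m).map L).count 0 := by
          rw [List.count_eq_length.2 (by
            intro b hb
            obtain ⟨a, ha, rfl⟩ := List.mem_map.1 hb
            exact (h0 a ha).symm)]
          simp [hlen]
        _ ≤ (r.map L).count 0 := (List.Sublist.map L (List.take_sublist m r)).count_le 0
        _ ≤ _ := by rw [rowWord_cons, List.map_append, List.count_append]; omega
    · rw [hn]
      intro hmn
      have hlen : n ≤ r.length := by
        have := congrArg List.length hr; simp at this; omega
      have h0 : ∀ a ∈ r.take m, L a = 0 := by
        intro a ha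
        have : L a ∈ (r.map L).take m := by
          rw [← List.map_take]; exact List.mem_map_of_mem ha
        rw [hr, List.take_append_of_le_length (by simpa using hmn), List.take_replicate] at this
        exact List.eq_of_mem_replicate this
      refine ⟨by simpa [firstRow] using hmn.trans hlen, ?_⟩
      simp only [firstRow, List.headD_cons, List.tail_cons]
      intro a ha b hb
      rw [List.mem_append, mem_flatten_iff] at hb
      rcases hb with hb | hb
      · rw [rowWord_cons] at hw
        have := sorted_lt h1 hw.of_append_right
        rw [← List.take_append_drop m r, List.pairwise_append] at this
        exact this.2.2 a ha b hb
      · by_contra hab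
        have h4 := hL.mono hw (a := b) (b := a) (by simp [hb])
          (by simp [List.mem_of_mem_take ha]) (by omega)
        have h5 := ht b hb
        have h6 := h0 a ha
        omega

/-- Lists of the parts of partitions. -/
def IsPartList (l : List ℕ) : Prop := l.Pairwise (· ≥ ·) ∧ ∀ a ∈ l, 1 ≤ a

theorem isPartList_nil : IsPartList [] := by simp [IsPartList]

theorem isPartList_cons {m : ℕ} {l : List ℕ} :
    IsPartList (m :: l) ↔ 1 ≤ m ∧ (∀ a ∈ l, a ≤ m) ∧ IsPartList l := by
  simp only [IsPartList, List.pairwise_cons, List.mem_cons, forall_eq_or_imp]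
  tauto

/-- The function giving the parts of a list, continued by zeros. -/
def shape (l : List ℕ) (i : ℕ) : ℕ := l.getD i 0

@[simp] theorem shape_cons_zero (m : ℕ) (l : List ℕ) : shape (m :: l) 0 = m := rfl

@[simp] theorem shape_cons_succ (m : ℕ) (l : List ℕ) (i : ℕ) :
    shape (m :: l) (i + 1) = shape l i := rfl

theorem shape_antitone {l : List ℕ} (h : IsPartList l) : Antitone (shape l) := by
  refine antitone_nat_of_succ_le fun i => ?_
  induction l generalizing i with
  | nil => simp [shape]
  | cons m l ih =>
    rw [isPartList_cons] at h
    cases i with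
    | zero => cases l with
      | nil => simp [shape]
      | cons a l => simpa using h.2.1 a (by simp)
    | succ i => simpa using ih h.2.2 i



/-- Up to a shift by one, the new labels are those of a word in which the algorithm has rotated `C`
and left `A` alone. -/
theorem map_rotLab {A C : List ℕ} {L : ℕ → ℕ} (hAC : ∀ v ∈ A, v ∉ C) (hA : ∀ v ∈ A, 1 ≤ L v) :
    ((C ++ A).map (rotLab L C)).map (· + 1) = (C.map L).map (· + 1) ++ A.map L := by
  rw [List.map_append, List.map_append, List.map_map, List.map_map, List.map_map]
  congr 1
  · exact List.map_congr_left fun v hv => by simp [rotLab, hv]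
  · refine List.map_congr_left fun v hv => ?_
    have := hA v hv
    simp [rotLab, hAC v hv]; omega

theorem rowWord_map_sublist {f : List ℕ → List ℕ} (hf : ∀ r, (f r).Sublist r) (T : Filling) :
    (rowWord (T.map f)).Sublist (rowWord T) := by
  induction T with
  | nil => simp
  | cons r t ih => simpa using ih.append (hf r)

/-! ### One catabolism as one filled row -/

section Step

variable {r : List ℕ} {t : Filling} {L : ℕ → ℕ} {m : ℕ}

theorem disjoint_of_nodup_append {A B C : List ℕ} (h : (A ++ (B ++ C)).Nodup) :
    ∀ v ∈ A, v ∉ C := by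
  intro v hv hv'
  rw [List.nodup_append] at h
  exact h.2.2 v hv v (by simp [hv']) rfl

theorem nodup_rotate {A B C : List ℕ} (h : (A ++ (B ++ C)).Nodup) : (C ++ A).Nodup := by
  have : (A ++ C).Nodup := h.sublist (List.Sublist.append_left (by simp) A)
  exact List.perm_append_comm.nodup_iff.1 this

/-- The first row has labels `0, …, 0` and then positive ones. Processing it fills row zero with `m`
cells and rotates the labels of `r.drop m` to the front, which is the word of `cat m` with its new
labels. -/
theorem cat_step (hT : IsTab (r :: t)) (hw : (rowWord (r :: t)).Nodup)
    (hL : IsLab (rowWord (r :: t)) L) (hm : 1 ≤ m) (hs : HasSmallest m (r :: t)) :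
    (r.drop m ++ rowWord t).Nodup ∧ IsLab (r.drop m ++ rowWord t) (rotLab L (r.drop m)) ∧
      ∀ l, IsPartList (m :: l) →
        (Good (shape (m :: l)) ((rowWord (r :: t)).map L) (firstRows (shape (m :: l)) 0) ↔
          Good (shape l) ((r.drop m ++ rowWord t).map (rotLab L (r.drop m)))
            (firstRows (shape l) 0)) := by
  obtain ⟨⟨n, e, hr, he, hn⟩, ht⟩ := hT.zeros hw hL
  have h0 := hs.lab_eq_zero hT.2.1 hL
  have hmn : m ≤ n := hn ▸ (hasSmallest_iff hT hw hL).1 hs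
  have hword : rowWord (r :: t) = rowWord t ++ (r.take m ++ r.drop m) := by simp
  rw [hword] at hw hL
  have hlen := hs.1
  simp only [firstRow, List.headD_cons] at hlen
  refine ⟨nodup_rotate hw, hL.rotate hw ?_ h0 ?_ ht, fun l hl => ?_⟩
  · intro h
    have := congrArg List.length h
    simp at this; rcases this with h | h <;> [omega; (subst h; simp at hlen; omega)]
  · intro b hb v hv
    refine hs.2 b hb v ?_
    simp only [List.mem_append, mem_flatten_iff, firstRow, List.headD_cons, List.tail_cons] at hv ⊢
    tauto
  · have hc := shape_antitone hl
    rw [← good_shift (c := shape (m :: l)) (c' := shape l) (hc zero_le_one) fun i => rfl,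
      map_rotLab (disjoint_of_nodup_append hw) ht, rowWord_cons, List.map_append, hr,
      good_process_row hc (by simpa using hmn) he, List.map_drop, hr,
      List.drop_append_of_le_length (by simpa using hmn)]
    simp

theorem colCat_step (hT : IsTab (r :: t)) (hw : (rowWord (r :: t)).Nodup)
    (hL : IsLab (rowWord (r :: t)) L) (hm : 1 ≤ m) (hs : HasSmallest m (r :: t)) :
    (rowWord ((r :: t).map (List.drop m)) ++ rowWord (t.map (List.take m))).Nodup ∧
      IsLab (rowWord ((r :: t).map (List.drop m)) ++ rowWord (t.map (List.take m)))
        (rotLab L (rowWord ((r :: t).map (List.drop m)))) ∧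
      ∀ l, IsPartList (m :: l) →
        (Good (shape (m :: l)) ((rowWord (r :: t)).map L) (firstRows (shape (m :: l)) 0) ↔
          Good (shape l) ((rowWord ((r :: t).map (List.drop m)) ++
              rowWord (t.map (List.take m))).map (rotLab L (rowWord ((r :: t).map (List.drop m)))))
            (firstRows (shape l) 0)) := by
  obtain ⟨⟨n, e, hr, he, hn⟩, ht⟩ := hT.zeros hw hL
  have h0 := hs.lab_eq_zero hT.2.1 hL
  have hmn : m ≤ n := hn ▸ (hasSmallest_iff hT hw hL).1 hs
  have hsplit := rowWord_split m hT
  have hX := hT.relabel hw hL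
  have hsub : (rowWord (t.map (List.take m))).Sublist (rowWord t) :=
    rowWord_map_sublist (fun r => List.take_sublist m r) t
  have ht' : ∀ v ∈ rowWord (t.map (List.take m)), 1 ≤ L v := fun v hv => ht v (hsub.subset hv)
  have hlen := hs.1
  simp only [firstRow, List.headD_cons] at hlen
  have hword : rowWord ((r :: t).map (List.take m)) ++ rowWord ((r :: t).map (List.drop m)) =
      rowWord (t.map (List.take m)) ++ (r.take m ++ rowWord ((r :: t).map (List.drop m))) := by
    simp
  have hw' := hw
  have hL' := hL
  rw [hsplit.perm.nodup_iff, hword] at hw'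
  rw [isLab_iff_of_kEq hsplit hw, hword] at hL'
  refine ⟨nodup_rotate hw', hL'.rotate hw' ?_ h0 ?_ ht', fun l hl => ?_⟩
  · intro h
    have := congrArg List.length h
    simp at this; rcases this with h | h <;> [omega; (subst h; simp at hlen; omega)]
  · intro b hb v hv
    refine hs.2 b hb v ?_
    have hsub' : (rowWord (t.map (List.drop m))).Sublist (rowWord t) :=
      rowWord_map_sublist (fun r => List.drop_sublist m r) t
    simp only [List.mem_append, mem_flatten_iff, firstRow, List.headD_cons, List.tail_cons,
      List.map_cons, rowWord_cons] at hv ⊢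
    rcases hv with hv | hv | hv
    · exact Or.inr (hsub.subset hv)
    · exact Or.inr (hsub'.subset hv)
    · exact Or.inl hv
  · have hc := shape_antitone hl
    have hκ := firstRows_antitone hc 0
    rw [← good_shift (c := shape (m :: l)) (c' := shape l) (hc zero_le_one) fun i => rfl,
      map_rotLab (disjoint_of_nodup_append hw') ht', ← rowWord_relabel,
      Good.of_kEq hc hκ (rowWord_split m hX)]
    -- Row zero of the shape has exactly `m` cells, the width of the left part. After the right part
    -- is rotated, the `m` zeros of the left part fill this row without surplus.
    have e1 := good_rotate_right_part hc (l := m) hX (i := 0) (by simp) (by simp) 0 0 []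
    have e2 : ∀ (f : List ℕ → List ℕ), (∀ s, f (s.map L) = (f s).map L) → ∀ T : Filling,
        rowWord ((relabel L T).map f) = (rowWord (T.map f)).map L := by
      intro f hf T
      rw [← rowWord_relabel]
      simp [relabel, Function.comp_def, hf]
    have e3 := e2 (List.take m) (fun s => (List.map_take).symm) (r :: t)
    have e4 := e2 (List.drop m) (fun s => (List.map_drop).symm) (r :: t)
    rw [List.map_cons, rowWord_cons, List.map_append, List.map_take, hr,
      List.take_append_of_le_length (by simpa using hmn), List.take_replicate,
      min_eq_left hmn] at e3
    have e5 := good_process_row hc (i := 0) (n := m) (by simp) (e := [])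
      (w := ((rowWord ((r :: t).map (List.drop m))).map L).map (· + 1) ++
        (rowWord (t.map (List.take m))).map L) (by simp)
    simp only [List.replicate_zero, List.nil_append, Nat.add_zero, shape_cons_zero, Nat.sub_self,
      List.append_nil, List.map_nil, List.append_assoc] at e1 e5
    rw [e1, e3, e4, e5]

end Step

/-! ### Both kinds of catabolizability as one condition on labels -/

theorem insertionTableau_lab {w : List ℕ} {L : ℕ → ℕ} (hw : w.Nodup) (hL : IsLab w L) :
    (rowWord (insertionTableau w)).Nodup ∧ IsLab (rowWord (insertionTableau w)) L ∧
      KEq ((rowWord (insertionTableau w)).map L) (w.map L) := by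
  have h := rowWord_insertionTableau w
  have h1 : (rowWord (insertionTableau w)).Nodup := h.perm.nodup_iff.2 hw
  have h2 := (isLab_iff_of_kEq h h1).2 hL
  exact ⟨h1, h2, h.map_lab h1 h2⟩

theorem eq_nil_iff_good {T : Filling} (hT : IsTab T) {L : ℕ → ℕ} :
    T = [] ↔ Good (shape []) ((rowWord T).map L) (firstRows (shape []) 0) := by
  constructor
  · rintro rfl
    simp only [rowWord_nil, List.map_nil, good_nil]
    ext; simp [firstRows, shape]
  · rintro ⟨n, hn⟩
    have key : ∀ (n : ℕ) (x : List ℕ) (κ : ℕ → ℕ), Fills (shape []) n x κ → x = [] := by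
      intro n
      induction n with
      | zero => intro x κ h; cases x <;> simp_all [Fills]
      | succ n ih =>
        intro x κ h
        cases x with
        | nil => rfl
        | cons a x =>
          have : ¬ Addable (shape []) κ a := not_addable_of_le (by simp [shape])
          simp only [Fills, this, if_false] at h
          simpa using ih _ _ h
    have := key n _ _ hn
    cases T with
    | nil => rfl
    | cons r t =>
      simp at this
      exact absurd this.1 hT.1

theorem good_cons_imp_hasSmallest {T : Filling} (hT : IsTab T) {L : ℕ → ℕ}
    (hw : (rowWord T).Nodup) (hL : IsLab (rowWord T) L) {m : ℕ} {l : List ℕ}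
    (h : Good (shape (m :: l)) ((rowWord T).map L) (firstRows (shape (m :: l)) 0)) :
    HasSmallest m T := by
  rw [hasSmallest_iff hT hw hL]
  have := h.le_count
  rwa [firstRows_of_le le_rfl, Nat.zero_add] at this

theorem isCatabolizable_iff_good {l : List ℕ} (hl : IsPartList l) {T : Filling} (hT : IsTab T)
    {L : ℕ → ℕ} (hw : (rowWord T).Nodup) (hL : IsLab (rowWord T) L) :
    IsCatabolizable l T ↔ Good (shape l) ((rowWord T).map L) (firstRows (shape l) 0) := by
  induction l generalizing T L with
  | nil => exact eq_nil_iff_good hT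
  | cons m l ih =>
    have hl' := isPartList_cons.1 hl
    suffices h : HasSmallest m T → (IsCatabolizable l (cat m T) ↔
        Good (shape (m :: l)) ((rowWord T).map L) (firstRows (shape (m :: l)) 0)) from
      ⟨fun h' => (h h'.1).1 h'.2, fun h' =>
        have hs := good_cons_imp_hasSmallest hT hw hL h'
        ⟨hs, (h hs).2 h'⟩⟩
    intro hs
    cases T with
    | nil => rw [hasSmallest_nil] at hs; omega
    | cons r t =>
      obtain ⟨h1, h2, h3⟩ := cat_step hT hw hL hl'.1 hs
      obtain ⟨h4, h5, h6⟩ := insertionTableau_lab h1 h2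
      have hc := shape_antitone hl'.2.2
      rw [h3 l hl, ← Good.of_kEq hc (firstRows_antitone hc 0) h6]
      exact ih hl'.2.2 (isTab_insertionTableau _) h4 h5

theorem isColCatabolizable_iff_good {l : List ℕ} (hl : IsPartList l) {T : Filling} (hT : IsTab T)
    {L : ℕ → ℕ} (hw : (rowWord T).Nodup) (hL : IsLab (rowWord T) L) :
    IsColCatabolizable l T ↔ Good (shape l) ((rowWord T).map L) (firstRows (shape l) 0) := by
  induction l generalizing T L with
  | nil => exact eq_nil_iff_good hT
  | cons m l ih =>
    have hl' := isPartList_cons.1 hl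
    suffices h : HasSmallest m T → (IsColCatabolizable l (colCat m T) ↔
        Good (shape (m :: l)) ((rowWord T).map L) (firstRows (shape (m :: l)) 0)) from
      ⟨fun h' => (h h'.1).1 h'.2, fun h' =>
        have hs := good_cons_imp_hasSmallest hT hw hL h'
        ⟨hs, (h hs).2 h'⟩⟩
    intro hs
    cases T with
    | nil => rw [hasSmallest_nil] at hs; omega
    | cons r t =>
      obtain ⟨h1, h2, h3⟩ := colCat_step hT hw hL hl'.1 hs
      obtain ⟨h4, h5, h6⟩ := insertionTableau_lab h1 h2
      have hc := shape_antitone hl'.2.2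
      rw [h3 l hl, ← Good.of_kEq hc (firstRows_antitone hc 0) h6]
      exact ih hl'.2.2 (isTab_insertionTableau _) h4 h5

theorem isCatabolizable_iff_isColCatabolizable {l : List ℕ} (hl : IsPartList l) {T : Filling}
    (hT : IsTab T) (hw : (rowWord T).Nodup) : IsCatabolizable l T ↔ IsColCatabolizable l T := by
  obtain ⟨L, hL⟩ := exists_isLab hw
  rw [isCatabolizable_iff_good hl hT hw hL, isColCatabolizable_iff_good hl hT hw hL]

/-! ### Comparison of catabolisms of different sizes -/

/-- The tableau `U` with `s` put in front of its first row. -/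
def prepend (s : ℕ) (U : Filling) : Filling := (s :: firstRow U) :: U.tail

theorem rowInsert_prepend {s x : ℕ} (h : s ≤ x) (U : Filling) :
    rowInsert x (prepend s U) = prepend s (rowInsert x U) := by
  have hx : ¬ x < s := by omega
  cases U with
  | nil => simp [prepend, rowInsert_cons, rowInsert_nil, rowBump, firstRow, hx]
  | cons r t =>
    simp only [prepend, rowInsert_cons, rowBump, hx, if_false, firstRow, List.headD_cons,
      List.tail_cons]
    cases (rowBump x r).2 <;> simp

/-- A letter inserted first and never exceeding a later one is never bumped. -/
theorem insertionTableau_cons {s : ℕ} {w : List ℕ} (h : ∀ x ∈ w, s ≤ x) :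
    insertionTableau (s :: w) = prepend s (insertionTableau w) := by
  induction w using List.reverseRecOn with
  | nil => simp [insertionTableau, prepend, rowInsert_nil, firstRow]
  | append_singleton w x ih =>
    rw [← List.cons_append, insertionTableau_append_singleton, insertionTableau_append_singleton,
      ih fun y hy => h y (by simp [hy]), rowInsert_prepend (h x (by simp))]

theorem IsTab.firstRow_tail {U : Filling} (hU : IsTab U) :
    (firstRow U).Pairwise (· ≤ ·) ∧ Above (firstRow U) (firstRow U.tail) ∧ IsTab U.tail := by
  cases U with
  | nil => simp [firstRow, IsTab]
  | cons r t => exact hU.2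

theorem rowWord_eq_tail_append (U : Filling) : rowWord U = rowWord U.tail ++ firstRow U := by
  cases U <;> simp [firstRow]

theorem IsTab.head_le {z : ℕ} {s : List ℕ} {t : Filling} (h : IsTab ((z :: s) :: t)) :
    ∀ x ∈ rowWord ((z :: s) :: t), z ≤ x := by
  obtain ⟨-, h1, h2, h3⟩ := h
  have hs : ∀ x ∈ z :: s, z ≤ x := by
    simpa using (List.pairwise_cons.1 h1).1
  intro x hx
  rw [rowWord_cons, List.mem_append] at hx
  rcases hx with hx | hx
  · exact (h3.lt_of_above h2 hs x hx).le
  · exact hs x hx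

theorem HasSmallest.succ {U : Filling} {k s : ℕ} {r : List ℕ} (h : HasSmallest k U)
    (hd : (firstRow U).drop k = s :: r) (hs : ∀ x ∈ r ++ rowWord U.tail, s < x) :
    HasSmallest (k + 1) U := by
  have hlen : k < (firstRow U).length := by
    have := congrArg List.length hd; simp at this; omega
  have hd' : (firstRow U).drop (k + 1) = r := by
    rw [← List.drop_drop, hd]; rfl
  have ht : (firstRow U).take (k + 1) = (firstRow U).take k ++ [s] := by
    rw [List.take_add, hd]; simp
  refine ⟨hlen, ?_⟩
  rw [hd', ht]
  intro a ha b hb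
  rw [List.mem_append] at ha
  rcases ha with ha | ha
  · refine h.2 a ha b ?_
    rw [hd]; simp only [List.mem_append, List.mem_cons] at hb ⊢; tauto
  · simp only [List.mem_singleton] at ha
    subst ha
    exact hs b (by simpa [List.mem_append, mem_rowWord] using hb)

theorem HasSmallest.pred {U : Filling} (hU : IsTab U) (hw : (rowWord U).Nodup) {k : ℕ}
    (h : HasSmallest (k + 1) U) : HasSmallest k U ∧ ∃ s r, (firstRow U).drop k = s :: r ∧
      ∀ x ∈ r ++ rowWord U.tail, s < x := by
  rw [rowWord_eq_tail_append] at hw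
  have hsort := sorted_lt hU.firstRow_tail.1 hw.of_append_right
  obtain ⟨hlen, hlt⟩ := h
  obtain ⟨s, r, hd⟩ := List.exists_cons_of_length_pos (l := (firstRow U).drop k)
    (by simp; omega)
  have hd' : (firstRow U).drop (k + 1) = r := by
    rw [← List.drop_drop, hd]; rfl
  have ht : (firstRow U).take (k + 1) = (firstRow U).take k ++ [s] := by
    rw [List.take_add, hd]; simp
  rw [hd', ht] at hlt
  refine ⟨⟨by omega, ?_⟩, s, r, hd, fun x hx => hlt s (by simp) x (by
    simpa [List.mem_append, mem_rowWord] using hx)⟩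
  intro a ha b hb
  rw [List.mem_append] at hb
  rcases hb with hb | hb
  · rw [← List.take_append_drop k (firstRow U), List.pairwise_append] at hsort
    exact hsort.2.2 a ha b hb
  · exact hlt a (by simp [ha]) b (by simp [hb])

theorem cat_word_nodup {U : Filling} (hw : (rowWord U).Nodup) (k : ℕ) :
    ((firstRow U).drop k ++ rowWord U.tail).Nodup := by
  rw [rowWord_eq_tail_append] at hw
  exact (List.perm_append_comm.nodup_iff.1 hw).sublist
    (List.Sublist.append_right (List.drop_sublist _ _) _)

/-- If one more than the `k` letters removed are the smallest of the `k`-catabolism and form the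
beginning of its first row, then the next smallest letter is in the first row. -/
theorem exists_next_smallest {U : Filling} (hU : IsTab U) (hw : (rowWord U).Nodup) {k : ℕ}
    (h : HasSmallest (k + 1) (cat k U)) :
    ∃ s r, (firstRow U).drop k = s :: r ∧ ∀ x ∈ r ++ rowWord U.tail, s < x := by
  obtain ⟨h1, h2, h3⟩ := hU.firstRow_tail
  have hR := cat_word_nodup hw k
  rw [rowWord_eq_tail_append] at hw
  obtain ⟨L, hL⟩ := exists_isLab hR
  obtain ⟨h4, h5, -⟩ := insertionTableau_lab hR hL
  have hP := isTab_insertionTableau ((firstRow U).drop k ++ rowWord U.tail)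
  have hperm := (rowWord_insertionTableau ((firstRow U).drop k ++ rowWord U.tail)).perm
  unfold cat at h
  generalize insertionTableau ((firstRow U).drop k ++ rowWord U.tail) = P at *
  cases P with
  | nil => rw [hasSmallest_nil] at h; omega
  | cons p q =>
    have hzero := h.lab_eq_zero hP.2.1 h5
    obtain ⟨hlen, hlt⟩ := h
    simp only [firstRow, List.headD_cons, List.tail_cons] at hlen hlt
    rw [rowWord_cons] at h4 hperm
    have hSR : ∀ v ∈ p.take (k + 1), v ∈ (firstRow U).drop k ++ rowWord U.tail := fun v hv =>
      hperm.mem_iff.1 (by simp [List.mem_of_mem_take hv])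
    have hSnd : (p.take (k + 1)).Nodup := h4.of_append_right.sublist (List.take_sublist _ _)
    by_contra hcon
    -- If the conclusion fails, the smallest remaining letter opens the second row.
    have hz : ∃ z s t', U.tail = (z :: s) :: t' ∧
        ∀ x ∈ (firstRow U).drop k ++ rowWord U.tail, z ≤ x := by
      have hne : U.tail ≠ [] := by
        intro ht
        rw [ht, rowWord_nil, List.append_nil] at hSR hperm
        rcases hd : (firstRow U).drop k with _ | ⟨s, r⟩
        · have := hperm.length_eq
          simp [hd] at this
          rw [this.2] at hlen
          simp at hlen
        · refine hcon ⟨s, r, hd, ?_⟩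
          rw [ht, rowWord_nil, List.append_nil]
          have := sorted_lt h1 hw.of_append_right
          have := this.sublist (List.drop_sublist k _)
          rw [hd, List.pairwise_cons] at this
          exact this.1
      obtain ⟨f, t', hft⟩ := List.exists_cons_of_ne_nil hne
      rw [hft] at h3
      obtain ⟨z, s, rfl⟩ := List.exists_cons_of_ne_nil h3.1
      refine ⟨z, s, t', hft, ?_⟩
      have hz := h3.head_le
      rw [hft]
      intro x hx
      rw [List.mem_append] at hx
      rcases hx with hx | hx
      · rcases hd : (firstRow U).drop k with _ | ⟨y, r⟩
        · simp [hd] at hx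
        · have hsort := sorted_lt h1 hw.of_append_right
          have hsort := hsort.sublist (List.drop_sublist k _)
          rw [hd, List.pairwise_cons] at hsort
          have hyx : y ≤ x := by
            rw [hd, List.mem_cons] at hx
            rcases hx with rfl | hx
            · exact le_rfl
            · exact (hsort.1 x hx).le
          by_contra hzx
          refine hcon ⟨y, r, hd, fun a ha => ?_⟩
          rw [List.mem_append] at ha
          rcases ha with ha | ha
          · exact hsort.1 a ha
          · rw [hft] at ha
            have := hz a ha
            omega
      · exact hz x hx
    obtain ⟨z, s, t', ht, hzmin⟩ := hz
    rw [ht] at hzmin hSR h2 hL hR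
    have hf : firstRow ((z :: s) :: t') = z :: s := rfl
    rw [hf] at h2
    have hzmem : z ∈ (firstRow U).drop k ++ rowWord ((z :: s) :: t') := by simp
    have hLz := hL.zero z hzmem hzmin
    -- A larger letter standing before `z` would have a positive label, but the letters in question
    -- have label zero. So they all lie in the row of `z`.
    have hSf : ∀ v ∈ p.take (k + 1), v ∈ z :: s := by
      intro v hv
      by_contra hvf
      have hzv : z < v := lt_of_le_of_ne (hzmin v (hSR v hv)) fun h => hvf (by simp [h])
      have hB : Before ((firstRow U).drop k ++ rowWord ((z :: s) :: t')) v z := by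
        have := hSR v hv
        rw [List.mem_append, rowWord_cons, List.mem_append] at this
        rw [before_append, rowWord_cons, before_append]
        rcases this with h' | h' | h'
        · exact Or.inr (Or.inr ⟨h', by simp⟩)
        · exact Or.inr (Or.inl (Or.inr (Or.inr ⟨h', by simp⟩)))
        · exact absurd h' hvf
      have := hL.strictMono hR hzv hB
      have := hzero v hv
      omega
    have hSlen : (p.take (k + 1)).length = k + 1 := by simp [hlen]
    have hflen : k + 1 ≤ (z :: s).length := hSlen ▸ (hSnd.subperm hSf).length_le
    -- `y` is the entry of the second row in column `k`, counted from zero, and `x` below denotes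
    -- the entry above it. The `k + 1` letters turn out to be less than `x < y`, hence to lie among
    -- the first `k` entries of the second row, which is impossible.
    obtain ⟨y, f', hy⟩ := List.exists_cons_of_length_pos (l := (z :: s).drop k)
      (by rw [List.length_drop]; omega)
    have hab := h2.drop k
    rw [hy] at hab
    rcases hd : (firstRow U).drop k with _ | ⟨x, r⟩
    · simp [hd] at hab
    · rw [hd, above_cons] at hab
      have hxU : x ∈ firstRow U := List.mem_of_mem_drop (i := k) (by simp [hd])
      have hxS : ∀ a ∈ p.take (k + 1), a < x := by
        intro a ha
        refine hlt a ha x ?_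
        have hx1 : x ∈ rowWord q ++ p := hperm.mem_iff.2 (by simp [hd])
        have hx2 : x ∉ p.take (k + 1) := by
          intro hx
          rw [List.nodup_append, ht, rowWord_cons] at hw
          exact hw.2.2 x (List.mem_append.2 (Or.inr (hSf x hx))) x hxU rfl
        rw [← List.take_append_drop (k + 1) p] at hx1
        simp only [List.mem_append, mem_flatten_iff] at hx1 ⊢
        tauto
      have hsub : ∀ a ∈ p.take (k + 1), a ∈ (z :: s).take k := by
        intro a ha
        have hay := (hxS a ha).trans hab.1
        have := hSf a ha
        rw [← List.take_append_drop k (z :: s), List.mem_append] at this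
        rcases this with h' | h'
        · exact h'
        · rw [ht] at h3
          have hs := h3.2.1.sublist (List.drop_sublist k _)
          rw [hy] at hs h'
          rw [List.pairwise_cons] at hs
          rcases List.mem_cons.1 h' with rfl | h'
          · omega
          · have := hs.1 a h'; omega
      have := (hSnd.subperm hsub).length_le
      rw [hSlen, List.length_take] at this
      omega

theorem cat_eq_prepend {U : Filling} {k s : ℕ} {r : List ℕ} (hd : (firstRow U).drop k = s :: r)
    (hs : ∀ x ∈ r ++ rowWord U.tail, s < x) : cat k U = prepend s (cat (k + 1) U) := by
  have hd' : (firstRow U).drop (k + 1) = r := by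
    rw [← List.drop_drop, hd]; rfl
  rw [cat, cat, hd, hd', List.cons_append, insertionTableau_cons fun x hx => (hs x hx).le]

theorem mem_rowWord_cat {U : Filling} {k x : ℕ} :
    x ∈ rowWord (cat k U) ↔ x ∈ (firstRow U).drop k ++ rowWord U.tail :=
  (rowWord_insertionTableau _).perm.mem_iff

theorem nodup_rowWord_cat {U : Filling} (hw : (rowWord U).Nodup) (k : ℕ) :
    (rowWord (cat k U)).Nodup :=
  (rowWord_insertionTableau _).perm.nodup_iff.2 (cat_word_nodup hw k)

theorem eq_nil_of_rowWord_eq_nil {T : Filling} (hT : IsTab T) (h : rowWord T = []) : T = [] := by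
  cases T with
  | nil => rfl
  | cons r t => simp at h; exact absurd h.2 hT.1

/-- Removing the smallest entry of a tableau from the front of its first row lowers the partial
sums of a partition for which it is catabolizable by one at most. -/
theorem IsCatabolizable.of_prepend {l : List ℕ} (hl : IsPartList l) {U : Filling} (hU : IsTab U)
    (hw : (rowWord U).Nodup) {s : ℕ} (h : IsCatabolizable l (prepend s U)) :
    ∃ l', IsPartList l' ∧ (∀ B, (∀ a ∈ l, a ≤ B) → ∀ a ∈ l', a ≤ B) ∧ IsCatabolizable l' U ∧
      ∀ j, (l.take j).sum ≤ (l'.take j).sum + 1 := by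
  induction l generalizing U s with
  | nil => simp [IsCatabolizable, prepend] at h
  | cons m l ih =>
    obtain ⟨hm, hlm, hl'⟩ := isPartList_cons.1 hl
    obtain ⟨hs, hc⟩ := h
    obtain ⟨k, rfl⟩ : ∃ k, m = k + 1 := ⟨m - 1, by omega⟩
    have hcat : cat (k + 1) (prepend s U) = cat k U := rfl
    rw [hcat] at hc
    have hsk : HasSmallest k U := by
      obtain ⟨h1, h2⟩ := hs
      refine ⟨by simpa [prepend, firstRow] using h1, fun a ha b hb => h2 a ?_ b hb⟩
      exact List.mem_cons_of_mem s ha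
    -- If the later parts are at most `k`, the first part absorbs the loss. Otherwise the second
    -- part is `k + 1` too; then the first part is kept and the loss is passed on to the rest.
    by_cases hlk : ∀ a ∈ l, a ≤ k
    · rcases Nat.eq_zero_or_pos k with rfl | hk
      · obtain rfl : l = [] := List.eq_nil_iff_forall_not_mem.2 fun a ha => by
          have := hlk a ha; have := hl'.2 a ha; omega
        refine ⟨[], isPartList_nil, by simp, ?_, fun j => by cases j <;> simp⟩
        refine eq_nil_of_rowWord_eq_nil hU (List.eq_nil_iff_forall_not_mem.2 fun x hx => ?_)
        have : x ∈ rowWord (cat 0 U) := by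
          rw [mem_rowWord_cat]
          rw [rowWord_eq_tail_append] at hx
          simp only [List.mem_append, List.drop_zero] at hx ⊢; tauto
        rw [show cat 0 U = [] from hc] at this
        simp at this
      · refine ⟨k :: l, isPartList_cons.2 ⟨hk, hlk, hl'⟩, ?_, ⟨hsk, hc⟩, ?_⟩
        · intro B hB
          simp only [List.mem_cons, forall_eq_or_imp] at hB ⊢
          exact ⟨by omega, hB.2⟩
        · intro j
          cases j with
          | zero => simp
          | succ j => simp only [List.take_succ_cons, List.sum_cons]; omega
    · rcases l with _ | ⟨m, l⟩
      · simp at hlk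
      · obtain rfl : m = k + 1 := by
          have h1 := hlm m (by simp)
          have h2 := (isPartList_cons.1 hl').2.1
          by_contra hne
          refine hlk fun a ha => ?_
          rcases List.mem_cons.1 ha with rfl | ha
          · omega
          · have := h2 a ha; omega
        obtain ⟨s', r, hd, hs'⟩ := exists_next_smallest hU hw hc.1
        rw [cat_eq_prepend hd hs'] at hc
        obtain ⟨l1, h1, h2, h3, h4⟩ := ih hl' (isTab_insertionTableau _)
          (nodup_rowWord_cat hw _) hc
        refine ⟨(k + 1) :: l1, isPartList_cons.2 ⟨hm, h2 _ hlm, h1⟩, ?_,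
          ⟨hsk.succ hd hs', h3⟩, ?_⟩
        · intro B hB
          simp only [List.mem_cons, forall_eq_or_imp] at hB ⊢
          exact ⟨hB.1, h2 B (by simpa using hB.2)⟩
        · intro j
          cases j with
          | zero => simp
          | succ j =>
            have := h4 j; simp only [List.take_succ_cons, List.sum_cons] at this ⊢; omega

/-- Each of the `m - p` further cells removed is the smallest entry of the current catabolism and
opens its first row, so each costs at most one. -/
theorem exists_isCatabolizable_cat {U : Filling} (hU : IsTab U) (hw : (rowWord U).Nodup)
    {l : List ℕ} (hl : IsPartList l) {p m : ℕ} (hpm : p ≤ m) (hm : HasSmallest m U)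
    (h : IsCatabolizable l (cat p U)) :
    ∃ l', IsPartList l' ∧ (∀ B, (∀ a ∈ l, a ≤ B) → ∀ a ∈ l', a ≤ B) ∧
      IsCatabolizable l' (cat m U) ∧ ∀ j, (l.take j).sum ≤ (l'.take j).sum + (m - p) := by
  induction m, hpm using Nat.le_induction with
  | base => exact ⟨l, hl, fun _ h => h, h, fun j => by omega⟩
  | succ m hpm ih =>
    obtain ⟨hm', s, r, hd, hs⟩ := hm.pred hU hw
    obtain ⟨l1, h1, h2, h3, h4⟩ := ih hm'
    rw [cat_eq_prepend hd hs] at h3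
    obtain ⟨l2, h5, h6, h7, h8⟩ := h3.of_prepend h1 (isTab_insertionTableau _)
      (nodup_rowWord_cat hw _)
    refine ⟨l2, h5, fun B hB => h6 B (h2 B hB), h7, fun j => ?_⟩
    have := h4 j
    have := h8 j
    omega

/-! ### The column catabolizability is the catabolizability -/

theorem hasSmallest_zero (T : Filling) : HasSmallest 0 T := by simp [HasSmallest]

theorem hasSmallest_maxSmallest (T : Filling) : HasSmallest (maxSmallest T) T :=
  Nat.findGreatest_spec (P := fun m => HasSmallest m T) (Nat.zero_le _) (hasSmallest_zero T)

theorem HasSmallest.le_maxSmallest {T : Filling} {m : ℕ} (h : HasSmallest m T) :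
    m ≤ maxSmallest T :=
  Nat.le_findGreatest h.1 h

theorem hasSmallest_one {T : Filling} (hT : IsTab T) (hw : (rowWord T).Nodup) (hne : T ≠ []) :
    HasSmallest 1 T := by
  obtain ⟨r, t, rfl⟩ := List.exists_cons_of_ne_nil hne
  obtain ⟨z, s, rfl⟩ := List.exists_cons_of_ne_nil hT.1
  refine ⟨by simp [firstRow], ?_⟩
  simp only [firstRow, List.headD_cons, List.tail_cons, List.mem_append, mem_flatten_iff]
  intro a ha b hb
  obtain rfl : a = z := by simpa using ha
  refine lt_of_le_of_ne (hT.head_le b ?_) ?_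
  · simp only [rowWord_cons, List.mem_append, List.mem_cons]; simp at hb; tauto
  · rintro rfl
    rw [rowWord_cons, List.nodup_append] at hw
    rcases hb with hb | hb
    · exact (List.nodup_cons.1 hw.2.1).1 (by simpa using hb)
    · exact hw.2.2 a hb a (by simp) rfl

theorem colCat_perm {r : List ℕ} {t : Filling} (hT : IsTab (r :: t)) (m : ℕ) :
    (rowWord (colCat m (r :: t)) ++ r.take m).Perm (rowWord (r :: t)) := by
  have h1 := (rowWord_split m hT).perm.symm
  have h2 := (rowWord_insertionTableau
    (rowWord ((r :: t).map (List.drop m)) ++ rowWord (t.map (List.take m)))).perm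
  refine (h2.append_right _).trans (List.Perm.trans ?_ h1)
  rw [List.append_assoc]
  have : rowWord (t.map (List.take m)) ++ r.take m = rowWord ((r :: t).map (List.take m)) := by
    simp
  rw [this]
  exact List.perm_append_comm

/-- After a column catabolism of maximal size `m`, at most `m` of the smallest entries form the
beginning of the first row. -/
theorem HasSmallest.le_of_colCat {r : List ℕ} {t : Filling} (hT : IsTab (r :: t))
    (hw : (rowWord (r :: t)).Nodup) {p : ℕ}
    (h : HasSmallest p (colCat (maxSmallest (r :: t)) (r :: t))) :
    p ≤ maxSmallest (r :: t) := by
  obtain ⟨L, hL⟩ := exists_isLab hw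
  have hs := hasSmallest_maxSmallest (r :: t)
  have hmax := fun k => HasSmallest.le_maxSmallest (T := r :: t) (m := k)
  have hm := hmax 1 (hasSmallest_one hT hw (by simp))
  generalize maxSmallest (r :: t) = m at *
  obtain ⟨h1, h2, -⟩ := colCat_step hT hw hL hm hs
  obtain ⟨h3, h4, -⟩ := insertionTableau_lab h1 h2
  obtain ⟨-, ht⟩ := hT.zeros hw hL
  have hcount : ((rowWord (r :: t)).map L).count 0 = m :=
    le_antisymm (hmax _ ((hasSmallest_iff hT hw hL).2 le_rfl)) ((hasSmallest_iff hT hw hL).1 hs)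
  have hsplit := rowWord_split m hT
  have hlen := hs.1
  simp only [firstRow, List.headD_cons] at hlen
  have htake : ((r.take m).map L).count 0 = m := by
    rw [List.count_eq_length.2]
    · simp [hlen]
    · intro b hb
      obtain ⟨a, ha, rfl⟩ := List.mem_map.1 hb
      exact (hs.lab_eq_zero hT.2.1 hL a ha).symm
  rw [(hsplit.perm.map L).count_eq, List.map_append, List.count_append, List.map_cons (f := List.take m),
    rowWord_cons, List.map_append, List.count_append, htake] at hcount
  -- By maximality of `m`, the first `m` cells of the first row carry all the zero labels.
  have hC : ((rowWord ((r :: t).map (List.drop m))).map L).count 0 = 0 := by omega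
  have hp := (hasSmallest_iff (isTab_insertionTableau _) h3 h4).1 h
  rw [((rowWord_insertionTableau _).perm.map _).count_eq] at hp
  have hsub : (rowWord (t.map (List.take m))).Sublist (rowWord t) :=
    rowWord_map_sublist (fun r => List.take_sublist m r) t
  have hw' := hw
  rw [hsplit.perm.nodup_iff, List.map_cons (f := List.take m), rowWord_cons,
    List.append_assoc] at hw'
  have hrot := map_rotLab (disjoint_of_nodup_append hw') fun v hv => ht v (hsub.subset hv)
  -- After a shift by one, the new zeros are the old zeros of the right part, of which there are
  -- none, and the old ones of the left part below the first row.
  rw [← List.count_map_of_injective _ (· + 1) (add_left_injective 1), hrot, List.count_append,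
    List.count_map_of_injective _ (· + 1) (add_left_injective 1), hC, Nat.zero_add] at hp
  refine hp.trans ?_
  cases t with
  | nil => simp
  | cons s t =>
    -- Labels increase strictly down the columns, so below the first row the label one occurs in the
    -- second row only, of which at most `m` cells belong to the left part.
    have hX := hT.relabel hw hL
    have hs1 : ∀ a ∈ s.map L, 0 + 1 ≤ a := by
      intro b hb
      obtain ⟨a, ha, rfl⟩ := List.mem_map.1 hb
      exact ht a (by simp [ha])
    have ht2 := hX.2.2.2.2.2.2.lt_of_above hX.2.2.2.2.2.1 hs1
    have e1 : rowWord (List.map (List.map L) t) = (rowWord t).map L := rowWord_relabel L t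
    rw [e1] at ht2
    rw [List.map_cons, rowWord_cons, List.map_append, List.count_append,
      List.count_eq_zero_of_not_mem]
    · have : (List.map L (List.take m s)).count (0 + 1) ≤ _ := List.count_le_length
      simp only [List.length_map, List.length_take] at this
      omega
    · intro hmem
      obtain ⟨a, ha, hL1⟩ := List.mem_map.1 hmem
      have hsub' : (rowWord (t.map (List.take m))).Sublist (rowWord t) :=
        rowWord_map_sublist (fun r => List.take_sublist m r) t
      have := ht2 (L a) (List.mem_map_of_mem (hsub'.subset ha))
      omega

/-- The greedy column sequence is shown by induction on the number of cells to be the largest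
partition for row catabolizability; the bound `K` on the number of steps is never exhausted too
early, as each step removes a cell. -/
theorem exists_catabolizability (n : ℕ) {T : Filling} (hT : IsTab T) (hw : (rowWord T).Nodup)
    (hn : (rowWord T).length = n) :
    ∃ l, IsPartList l ∧ l.sum = n ∧ IsCatabolizable l T ∧
      (∀ k, IsPartList k → IsCatabolizable k T → ∀ j, (k.take j).sum ≤ (l.take j).sum) ∧
      ∀ K, n ≤ K → greedyColCat K T = l := by
  induction n using Nat.strong_induction_on generalizing T with
  | _ n ih =>
    cases T with
    | nil =>
      refine ⟨[], isPartList_nil, by simpa using hn, rfl, fun k hk hc => ?_, fun K _ => ?_⟩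
      · cases k with
        | nil => simp
        | cons m k =>
          have := hasSmallest_nil.1 hc.1
          have := (isPartList_cons.1 hk).1
          omega
      · cases K <;> rfl
    | cons r t =>
      have hs := hasSmallest_maxSmallest (r :: t)
      have hmax := fun k => HasSmallest.le_maxSmallest (T := r :: t) (m := k)
      have hm := hmax 1 (hasSmallest_one hT hw (by simp))
      have hbound := fun p => HasSmallest.le_of_colCat hT hw (p := p)
      have hgreedy : ∀ K, greedyColCat (K + 1) (r :: t) = maxSmallest (r :: t) ::
        greedyColCat K (colCat (maxSmallest (r :: t)) (r :: t)) := fun K => rfl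
      generalize maxSmallest (r :: t) = m at *
      have hperm := colCat_perm hT m
      have hlen := hs.1
      simp only [firstRow, List.headD_cons] at hlen
      have hw1 : (rowWord (colCat m (r :: t))).Nodup := (hperm.nodup_iff.2 hw).of_append_left
      have hlen1 := hperm.length_eq
      rw [List.length_append, List.length_take, min_eq_left hlen, hn] at hlen1
      have hT1 : IsTab (colCat m (r :: t)) := isTab_insertionTableau _
      obtain ⟨l, h1, h2, h3, h4, h5⟩ := ih (n - m) (by omega) hT1 hw1 (by omega)
      have hlm : ∀ a ∈ l, a ≤ m := by
        cases l with
        | nil => simp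
        | cons p l =>
          have hp := hbound p h3.1
          have := (isPartList_cons.1 h1).2.1
          intro a ha
          rcases List.mem_cons.1 ha with rfl | ha
          · exact hp
          · exact (this a ha).trans hp
      have hpart : IsPartList (m :: l) := isPartList_cons.2 ⟨hm, hlm, h1⟩
      refine ⟨m :: l, hpart, by simp; omega, ?_, ?_, ?_⟩
      · rw [isCatabolizable_iff_isColCatabolizable hpart hT hw]
        exact ⟨hs, (isCatabolizable_iff_isColCatabolizable h1 hT1 hw1).1 h3⟩
      · intro k hk hc j
        cases k with
        | nil => simp [IsCatabolizable] at hc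
        | cons p k =>
          obtain ⟨hp1, hkp, hk'⟩ := isPartList_cons.1 hk
          have hpm := hmax p hc.1
          -- The loss of at most `m - p` in the partial sums of the remaining parts is made up by
          -- the larger first part.
          obtain ⟨k1, h6, h7, h8, h9⟩ := exists_isCatabolizable_cat hT hw hk' hpm hs hc.2
          have hpart' : IsPartList (m :: k1) :=
            isPartList_cons.2 ⟨hm, fun a ha => (h7 p hkp a ha).trans hpm, h6⟩
          -- The equivalence for `m :: k1` carries `k1` over from `cat m` to `colCat m`, to which
          -- the induction hypothesis applies.
          have h10 : IsColCatabolizable (m :: k1) (r :: t) :=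
            (isCatabolizable_iff_isColCatabolizable hpart' hT hw).1 ⟨hs, h8⟩
          have h11 := h4 k1 h6 ((isCatabolizable_iff_isColCatabolizable h6 hT1 hw1).2 h10.2)
          cases j with
          | zero => simp
          | succ j =>
            have := h9 j
            have := h11 j
            simp only [List.take_succ_cons, List.sum_cons]
            omega
      · intro K hK
        obtain ⟨K, rfl⟩ : ∃ K', K = K' + 1 := ⟨K - 1, by omega⟩
        rw [hgreedy, h5 K (by omega)]

/-! ### Standard Young tableaux -/

theorem isTab_map_range {f : ℕ → List ℕ} {n : ℕ} (h0 : ∀ i < n, f i ≠ [])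
    (h1 : ∀ i < n, (f i).Pairwise (· ≤ ·)) (h2 : ∀ i, i + 1 < n → Above (f i) (f (i + 1))) :
    IsTab ((List.range n).map f) := by
  induction n generalizing f with
  | zero => trivial
  | succ n ih =>
    rw [List.range_succ_eq_map, List.map_cons, List.map_map]
    refine ⟨h0 0 (by omega), h1 0 (by omega), ?_, ih (fun i hi => h0 _ (by omega))
      (fun i hi => h1 _ (by omega)) fun i hi => h2 _ (by omega)⟩
    cases n with
    | zero => simp [firstRow]
    | succ n => simpa [List.range_succ_eq_map, firstRow] using h2 0 (by omega)

theorem above_map_range {f g : ℕ → ℕ} {m n : ℕ} (hmn : n ≤ m) (h : ∀ j < n, f j < g j) :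
    Above ((List.range m).map f) ((List.range n).map g) := by
  induction n generalizing m f g with
  | zero => simp
  | succ n ih =>
    obtain ⟨m, rfl⟩ : ∃ m', m = m' + 1 := ⟨m - 1, by omega⟩
    rw [List.range_succ_eq_map, List.range_succ_eq_map, List.map_cons, List.map_cons,
      List.map_map, List.map_map, above_cons]
    exact ⟨h 0 (by omega), ih (by omega) fun j hj => h _ (by omega)⟩

theorem isTab_rows {μ : YoungDiagram} (T : SemistandardYoungTableau μ) : IsTab (rows T) := by
  refine isTab_map_range (fun i hi => ?_) (fun i hi => ?_) fun i hi => ?_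
  · have : 0 < μ.rowLen i := by
      rw [← YoungDiagram.mem_iff_lt_rowLen, YoungDiagram.mem_iff_lt_colLen]; exact hi
    simp; omega
  · rw [List.pairwise_map]
    refine List.Pairwise.imp_of_mem ?_ (List.pairwise_lt_range (n := μ.rowLen i))
    intro a b _ hb hab
    exact T.row_weak hab (YoungDiagram.mem_iff_lt_rowLen.2 (List.mem_range.1 hb))
  · refine above_map_range (μ.rowLen_anti _ _ (Nat.le_succ i)) fun j hj => ?_
    exact T.col_strict (Nat.lt_succ_self i) (YoungDiagram.mem_iff_lt_rowLen.2 hj)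

theorem mem_rows_flatten {μ : YoungDiagram} (T : SemistandardYoungTableau μ) {v : ℕ} :
    v ∈ (rows T).flatten ↔ ∃ c ∈ μ.cells, T c.1 c.2 = v := by
  simp only [rows, List.mem_flatten, List.mem_map, List.mem_range, Prod.exists,
    YoungDiagram.mem_cells]
  constructor
  · rintro ⟨_, ⟨i, -, rfl⟩, hv⟩
    obtain ⟨j, hj, rfl⟩ := List.mem_map.1 hv
    exact ⟨i, j, YoungDiagram.mem_iff_lt_rowLen.2 (List.mem_range.1 hj), rfl⟩
  · rintro ⟨i, j, hc, rfl⟩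
    refine ⟨_, ⟨i, ?_, rfl⟩, List.mem_map.2 ⟨j, ?_, rfl⟩⟩
    · rw [← YoungDiagram.mem_iff_lt_colLen]
      exact μ.up_left_mem le_rfl (Nat.zero_le j) hc
    · exact List.mem_range.2 (YoungDiagram.mem_iff_lt_rowLen.1 hc)

theorem nodup_rows_flatten {μ : YoungDiagram} {T : SemistandardYoungTableau μ}
    (hT : IsStandard T) : (rows T).flatten.Nodup := by
  have hinj : ∀ i j i' j', (i, j) ∈ μ → (i', j') ∈ μ → T i j = T i' j' → i = i' ∧ j = j' := by
    intro i j i' j' h h' he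
    have := hT.injOn (x₁ := (i, j)) (x₂ := (i', j')) (by simpa using h) (by simpa using h') he
    simpa using this
  rw [List.nodup_flatten]
  constructor
  · intro l hl
    obtain ⟨i, -, rfl⟩ := List.mem_map.1 hl
    refine List.Nodup.map_on (fun j hj j' hj' he => ?_) List.nodup_range
    exact (hinj i j i j' (YoungDiagram.mem_iff_lt_rowLen.2 (List.mem_range.1 hj))
      (YoungDiagram.mem_iff_lt_rowLen.2 (List.mem_range.1 hj')) he).2
  · rw [rows, List.pairwise_map]
    refine List.nodup_range.imp fun {i i'} hne v hv hv' => ?_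
    obtain ⟨j, hj, rfl⟩ := List.mem_map.1 hv
    obtain ⟨j', hj', he⟩ := List.mem_map.1 hv'
    exact hne (hinj i' j' i j (YoungDiagram.mem_iff_lt_rowLen.2 (List.mem_range.1 hj'))
      (YoungDiagram.mem_iff_lt_rowLen.2 (List.mem_range.1 hj)) he).1.symm

theorem length_rows_flatten {μ : YoungDiagram} {T : SemistandardYoungTableau μ}
    (hT : IsStandard T) : (rows T).flatten.length = μ.card := by
  rw [← List.toFinset_card_of_nodup (nodup_rows_flatten hT)]
  have : (rows T).flatten.toFinset = Finset.Icc 1 μ.card := by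
    ext v
    rw [List.mem_toFinset, mem_rows_flatten]
    have := Set.ext_iff.1 hT.image_eq v
    simpa using this
  rw [this]; simp

theorem isPartList_partList {n : ℕ} (ν : Nat.Partition n) : IsPartList (partList ν) := by
  refine ⟨Multiset.pairwise_sort _ _, fun a ha => ?_⟩
  exact ν.parts_pos ((Multiset.mem_sort (r := (· ≥ ·))).1 ha)

theorem exists_partList_eq {n : ℕ} {l : List ℕ} (hl : IsPartList l) (hs : l.sum = n) :
    ∃ ν : Nat.Partition n, partList ν = l := by
  refine ⟨⟨(l : Multiset ℕ), fun {i} hi => hl.2 i (by simpa using hi), by simpa using hs⟩, ?_⟩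
  have h := isPartList_partList (n := n)
    ⟨(l : Multiset ℕ), fun {i} hi => hl.2 i (by simpa using hi), by simpa using hs⟩
  refine List.Perm.eq_of_pairwise' h.1 hl.1 ?_
  simpa [partList] using List.mergeSort_perm l _

end Catabolism

theorem mainTheorem6 (μ : YoungDiagram) (T : SemistandardYoungTableau μ)
    (hT : Catabolism.IsStandard T) :
    (∃ ν : Nat.Partition μ.card, Catabolism.IsCatabolizability T ν ∧
      Catabolism.colCatabolizability (Catabolism.rows T) = Catabolism.partList ν) ∧
    (∀ ν : Nat.Partition μ.card,
      Catabolism.IsCatabolizable (Catabolism.partList ν) (Catabolism.rows T) ↔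
        Catabolism.IsColCatabolizable (Catabolism.partList ν) (Catabolism.rows T)) := by
  open Catabolism in
  have hw : (rowWord (rows T)).Nodup := (rowWord_perm _).nodup_iff.2 (nodup_rows_flatten hT)
  have hlen := length_rows_flatten hT
  refine ⟨?_, fun ν => isCatabolizable_iff_isColCatabolizable (isPartList_partList ν)
    (isTab_rows T) hw⟩
  obtain ⟨l, h1, h2, h3, h4, h5⟩ := exists_catabolizability μ.card (isTab_rows T) hw
    ((rowWord_perm _).length_eq.trans hlen)
  obtain ⟨ν, rfl⟩ := exists_partList_eq h1 h2
  exact ⟨ν, ⟨h3, fun κ hκ => h4 _ (isPartList_partList κ) hκ⟩, h5 _ hlen.ge⟩
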